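/- Let $n,k\ge 1$ be integers and let $p_1,\dots,p_k\ge 1$ be real numbers with $(p_1,\dots,p_k)\neq(1,\dots,1)$. Consider the Cauchy problem $$\partial_t u_j-\Delta u_j=|u_{j+1}|^{p_j},\qquad u_j(0,\cdot)=u_{0,j}\qquad (1\le j\le k,\ u_{k+1}:=u_1)$$ on $[0,T)\times\mathbb R^n$ for real-valued $u_{0,j}\in L^1(\mathbb R^n)\cap L^\infty(\mathbb R^n)$. A solution on $[0,T)$ is a function $u=(u_1,\dots,u_k)$ with $u_j(0)=u_{0,j}$, $$u_j\in C([0,T);L^1(\mathbb R^n))\cap C((0,T);L^\infty(\mathbb R^n)),\qquad \sup_{0\le t\le S}\|u_j(t)\|_{L^\infty}<\infty\quad(0<S<T),$$ which satisfies, for all $j$ and $0<t<T$, almost everywhere in $\mathbb R^n$, $$u_j(t)=e^{t\Delta}u_{0,j}+\int_0^t e^{(t-\tau)\Delta}\,|u_{j+1}(\tau)|^{p_j}\,d\tau .$$ Here $e^{t\Delta}$ is convolution with $(4\pi t)^{-n/2}e^{-|x|^2/(4t)}$. The lifespan is $$T_m=T_m(u_0)=\sup\{T>0:\ \text{there is a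 unique solution on }[0,T)\}\in[0,\infty].$$ Let $\mathcal P$ be the $k\times k$ matrix with entries $p_j$ at the positions $(j,j+1)$ for $1\le j<k$, $p_k$ at the position $(k,1)$, and $0$ elsewhere. Let $\alpha=(\mathcal P-I)^{-1}(1,\dots,1)^{t}$ and $\alpha_{\max}=\max_j\alpha_j$. Put $\|u_0\|_{L^1\cap L^\infty}=\sum_{j=1}^k(\|u_{0,j}\|_{L^1}+\|u_{0,j}\|_{L^\infty})$. **Proposition.** There exist constants $\varepsilon_0>0$ and $C>0$, depending only on $n,k,p_1,\dots,p_k$, such that for every $u_0\in L^1(\mathbb R^n)\cap L^\infty(\mathbb R^n)$ with $\|u_0\|_{L^1\cap L^\infty}\le\varepsilon_0$: - if $\alpha_{\max}<n/2$, then $T_m=\infty$; - if $\alpha_{\max}>n/2$, then $T_m\ge C\,\|u_0\|_{L^1\cap L^\infty}^{-1/(\alpha_{\max}-n/2)}$ (the right-hand side being $\infty$ when $u_0=0$). -/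

import Mathlib

open MeasureTheory Filter Topology
open scoped ENNReal Matrix

noncomputable section

namespace HeatSystem

/-- The `k × k` matrix with the entry `p j` at `(j, j + 1)`, the indices being cyclic
(so that `p k` stands in the lower left corner), and `0` elsewhere. -/
def couplingMatrix {k : ℕ} [NeZero k] (p : Fin k → ℝ) : Matrix (Fin k) (Fin k) ℝ :=
  Matrix.of fun i j => if j = i + 1 then p i else 0

/-- The vector `α = (P - I)⁻¹ (1, …, 1)`. -/
def alpha {k : ℕ} [NeZero k] (p : Fin k → ℝ) : Fin k → ℝ :=
  (couplingMatrix p - 1)⁻¹ *ᵥ (fun _ => 1)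

/-- `α_max = max_j α_j`. -/
def alphaMax {k : ℕ} [NeZero k] (p : Fin k → ℝ) : ℝ :=
  Finset.univ.sup' Finset.univ_nonempty (alpha p)

/-- The Gauss kernel `(4πt)^{-n/2} exp(-|x|²/(4t))` on `ℝⁿ` (used for `t > 0`). -/
def heatKernel {n : ℕ} (t : ℝ) (x : EuclideanSpace ℝ (Fin n)) : ℝ :=
  (4 * Real.pi * t) ^ (-((n : ℝ) / 2)) * Real.exp (-(‖x‖ ^ 2 / (4 * t)))

/-- The heat semigroup `(e^{tΔ} f)(x) = ∫ G_t(x - y) f(y) dy` (used for `t > 0`). -/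
def heat {n : ℕ} (t : ℝ) (f : EuclideanSpace ℝ (Fin n) → ℝ) (x : EuclideanSpace ℝ (Fin n)) : ℝ :=
  ∫ y, heatKernel t (x - y) * f y

/-- The norm `‖v‖_{L¹ ∩ L^∞} = ∑_j (‖v_j‖_{L¹} + ‖v_j‖_{L^∞})` of an `ℝᵏ`-valued function. -/
def normL1Linf {n k : ℕ} (v : Fin k → EuclideanSpace ℝ (Fin n) → ℝ) : ℝ≥0∞ :=
  ∑ j, (eLpNorm (v j) 1 volume + eLpNorm (v j) ∞ volume)

/-- `u = (u_1, …, u_k)` is a solution on `[0, T)` of the Cauchy problem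
`∂_t u_j - Δ u_j = |u_{j+1}|^{p_j}` (cyclic indices), `u(0) = u₀`, in the sense of the
integral (Duhamel) equation. The value of `u_j` at time `t` is the function `u j t` on `ℝⁿ`.

The solution belongs to `L¹ ∩ L^∞` at all times and is continuous in time with values in
`L¹ ∩ L^∞`; since the heat semigroup is not strongly continuous at `t = 0` on `L^∞`, continuity
at `t = 0` is continuity in `L¹` together with boundedness in `L^∞`. -/
structure IsSolution {n k : ℕ} [NeZero k] (p : Fin k → ℝ)
    (u₀ : Fin k → EuclideanSpace ℝ (Fin n) → ℝ) (T : ℝ)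
    (u : Fin k → ℝ → EuclideanSpace ℝ (Fin n) → ℝ) : Prop where
  memLp_one : ∀ j, ∀ t ∈ Set.Ico 0 T, MemLp (u j t) 1 volume
  memLp_top : ∀ j, ∀ t ∈ Set.Ico 0 T, MemLp (u j t) ∞ volume
  continuous_one : ∀ j, ∀ t ∈ Set.Ico 0 T,
    Tendsto (fun s => eLpNorm (u j s - u j t) 1 volume) (𝓝[Set.Ico 0 T] t) (𝓝 0)
  continuous_top : ∀ j, ∀ t ∈ Set.Ioo 0 T,
    Tendsto (fun s => eLpNorm (u j s - u j t) ∞ volume) (𝓝[Set.Ioo 0 T] t) (𝓝 0)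
  bounded_top : ∀ j, ∀ S ∈ Set.Ioo 0 T, ∃ M : ℝ, ∀ t ∈ Set.Icc 0 S,
    eLpNorm (u j t) ∞ volume ≤ ENNReal.ofReal M
  initial : ∀ j, u j 0 =ᵐ[volume] u₀ j
  duhamel : ∀ j, ∀ t ∈ Set.Ioo 0 T, ∀ᵐ x ∂(volume : Measure (EuclideanSpace ℝ (Fin n))),
    u j t x = heat t (u₀ j) x +
      ∫ τ in (0 : ℝ)..t, heat (t - τ) (fun y => |u (j + 1) τ y| ^ p j) x

/-- There is exactly one solution on `[0, T)`, functions that agree almost everywhere in space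
at each time being identified. -/
def HasUniqueSolution {n k : ℕ} [NeZero k] (p : Fin k → ℝ)
    (u₀ : Fin k → EuclideanSpace ℝ (Fin n) → ℝ) (T : ℝ) : Prop :=
  ∃ u, IsSolution p u₀ T u ∧
    ∀ v, IsSolution p u₀ T v → ∀ j, ∀ t ∈ Set.Ico 0 T, v j t =ᵐ[volume] u j t

/-- The lifespan `T_m`, the supremum in `[0, ∞]` of all `T > 0` such that there is a unique
solution on `[0, T)`. -/
def lifespan {n k : ℕ} [NeZero k] (p : Fin k → ℝ)
    (u₀ : Fin k → EuclideanSpace ℝ (Fin n) → ℝ) : ℝ≥0∞ :=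
  sSup {θ : ℝ≥0∞ | ∃ T : ℝ, 0 < T ∧ θ = ENNReal.ofReal T ∧ HasUniqueSolution p u₀ T}

end HeatSystem

end

/-! The heat flow of a single function `w`, the sum of all `|u₀ j|`, controls the whole system.
Suppose `|u (j+1) τ| ≤ h (j+1) τ · e^{τΔ}w` and `e^{τΔ}w ≤ m τ`. Then `|u (j+1) τ| ^ p j ≤ h (j+1) τ
^ p j · m τ ^ (p j - 1) · e^{τΔ}w`. Applying `e^{(t-τ)Δ}` turns the last factor into `e^{tΔ}w`,
independent of `τ`. The system thus reduces to scalar inequalities `1 + ∫₀ᵗ h (j+1) ^ p j · m ^ (p j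
- 1) ≤ h j t` (`Supersolution`).

Let `N = n/2`. Data of size `ε` allow `m t = E (1+t)^{-N}` with `E = 2^N ε` (`heat_le_decay`). The
recurrence `p j · α (j+1) = α j + 1` (`mul_alpha_add_one`) suggests amplitudes with `h j · m`
proportional to `(1+t)^{γ - α j}`, where `γ = max(α_max - N, 0)`. In `one_add_integral_amplitude_le`
the powers of `1+t` then match up to an excess `(1+t)^{(p j - 1)γ}`, which a prefactor `(1+T)^{-γ}`
absorbs. The inequalities hold once `ε (1+T)^γ ≤ c`. For `γ = 0` this puts no restriction on `T`;
for `γ > 0` it allows `T` of order `ε^{-1/γ}`.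

Given a supersolution, Picard iteration converges pointwise on all of `(0,T]` in a norm weighted by
`e^{2Lt}` (`exists_fixedPoint`). Comparing heat kernels at two times gives continuity in `L¹` and
`L^∞` (`Supersolution.exists_isSolution`). Since `p j ≥ 1`, the powers are Lipschitz on bounded
sets, and the same exponential weight gives uniqueness among all solutions (`IsSolution.ae_eq`). -/

noncomputable section

namespace HeatSystem

/-! ### The Gauss kernel: mass, semigroup law, comparison of times -/

section Kernel

variable {n : ℕ}

lemma heatKernel_pos {t : ℝ} (ht : 0 < t) (x : EuclideanSpace ℝ (Fin n)) :
    0 < heatKernel t x := by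
  unfold heatKernel
  have := Real.pi_pos
  positivity

lemma measurable_heatKernel :
    Measurable (fun q : ℝ × EuclideanSpace ℝ (Fin n) => heatKernel q.1 q.2) := by
  unfold heatKernel
  fun_prop

lemma continuous_heatKernel (t : ℝ) :
    Continuous (fun x : EuclideanSpace ℝ (Fin n) => heatKernel t x) := by
  unfold heatKernel
  fun_prop

lemma heatKernel_le {t : ℝ} (ht : 0 < t) (x : EuclideanSpace ℝ (Fin n)) :
    heatKernel t x ≤ (4 * Real.pi * t) ^ (-((n : ℝ) / 2)) := by
  unfold heatKernel
  have := Real.pi_pos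
  refine mul_le_of_le_one_right (by positivity) ?_
  rw [Real.exp_le_one_iff]
  have : 0 ≤ ‖x‖ ^ 2 / (4 * t) := by positivity
  linarith

lemma integral_exp_neg_sq_norm_div {t : ℝ} (ht : 0 < t) :
    ∫ x : EuclideanSpace ℝ (Fin n), Real.exp (-(‖x‖ ^ 2 / (4 * t))) =
      (4 * Real.pi * t) ^ ((n : ℝ) / 2) := by
  have h := GaussianFourier.integral_rexp_neg_mul_sq_norm (V := EuclideanSpace ℝ (Fin n))
    (b := 1 / (4 * t)) (by positivity)
  rw [finrank_euclideanSpace_fin] at h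
  convert h using 2
  · ext x; congr 1; ring
  · field_simp

lemma integral_heatKernel {t : ℝ} (ht : 0 < t) :
    ∫ x : EuclideanSpace ℝ (Fin n), heatKernel t x = 1 := by
  unfold heatKernel
  have := Real.pi_pos
  rw [integral_const_mul, integral_exp_neg_sq_norm_div ht, ← Real.rpow_add (by positivity)]
  simp

lemma integrable_heatKernel {t : ℝ} (ht : 0 < t) :
    Integrable (fun x : EuclideanSpace ℝ (Fin n) => heatKernel t x) :=
  .of_integral_ne_zero (by rw [integral_heatKernel ht]; exact one_ne_zero)

/-- The heat kernel at a later time dominates a multiple of the heat kernel at an earlier time. -/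
lemma heatKernel_mono {a b : ℝ} (ha : 0 < a) (hab : a ≤ b) (x : EuclideanSpace ℝ (Fin n)) :
    (a / b) ^ ((n : ℝ) / 2) * heatKernel a x ≤ heatKernel b x := by
  have hb : 0 < b := ha.trans_le hab
  have hpi := Real.pi_pos
  unfold heatKernel
  have h1 : (a / b) ^ ((n : ℝ) / 2) * (4 * Real.pi * a) ^ (-((n : ℝ) / 2)) =
      (4 * Real.pi * b) ^ (-((n : ℝ) / 2)) := by
    rw [Real.rpow_neg (by positivity), Real.rpow_neg (by positivity),
      ← Real.inv_rpow (by positivity), ← Real.inv_rpow (by positivity),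
      ← Real.mul_rpow (by positivity) (by positivity)]
    congr 1
    field_simp
  rw [← mul_assoc, h1]
  gcongr

lemma integral_heatKernel_mul_heatKernel {s t : ℝ} (hs : 0 < s) (ht : 0 < t)
    (x : EuclideanSpace ℝ (Fin n)) :
    ∫ y, heatKernel s (x - y) * heatKernel t y = heatKernel (s + t) x := by
  have hpi := Real.pi_pos
  have hst : 0 < s + t := by positivity
  have key : ∀ y : EuclideanSpace ℝ (Fin n), heatKernel s (x - y) * heatKernel t y =
      ((4 * Real.pi * s) ^ (-((n : ℝ) / 2)) * (4 * Real.pi * t) ^ (-((n : ℝ) / 2)) *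
        Real.exp (-(‖x‖ ^ 2 / (4 * (s + t))))) *
      Real.exp (-(‖y - (t / (s + t)) • x‖ ^ 2 / (4 * (s * t / (s + t))))) := by
    intro y
    -- Completing the square in `y`: the product is a Gaussian centred at `t/(s+t) · x` with time
    -- parameter `st/(s+t)`.
    have hexp : -(‖x - y‖ ^ 2 / (4 * s)) + -(‖y‖ ^ 2 / (4 * t)) =
        -(‖x‖ ^ 2 / (4 * (s + t))) +
          -(‖y - (t / (s + t)) • x‖ ^ 2 / (4 * (s * t / (s + t)))) := by
      rw [norm_sub_sq_real, norm_sub_sq_real, inner_smul_right, norm_smul, mul_pow,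
        Real.norm_eq_abs, sq_abs, real_inner_comm y x]
      field_simp
      ring
    unfold heatKernel
    rw [mul_mul_mul_comm, ← Real.exp_add, hexp, Real.exp_add]
    ring
  simp_rw [key]
  rw [integral_const_mul, integral_sub_right_eq_self
    (fun y : EuclideanSpace ℝ (Fin n) => Real.exp (-(‖y‖ ^ 2 / (4 * (s * t / (s + t)))))),
    integral_exp_neg_sq_norm_div (by positivity)]
  unfold heatKernel
  have : (4 * Real.pi * s) ^ (-((n : ℝ) / 2)) * (4 * Real.pi * t) ^ (-((n : ℝ) / 2)) *
      (4 * Real.pi * (s * t / (s + t))) ^ ((n : ℝ) / 2) =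
      (4 * Real.pi * (s + t)) ^ (-((n : ℝ) / 2)) := by
    simp only [Real.rpow_neg (show 0 ≤ 4 * Real.pi * s by positivity),
      Real.rpow_neg (show 0 ≤ 4 * Real.pi * t by positivity),
      Real.rpow_neg (show 0 ≤ 4 * Real.pi * (s + t) by positivity)]
    rw [← Real.inv_rpow (by positivity), ← Real.inv_rpow (by positivity),
      ← Real.inv_rpow (by positivity), ← Real.mul_rpow (by positivity) (by positivity),
      ← Real.mul_rpow (by positivity) (by positivity)]
    congr 1
    field_simp
  rw [← this]
  ring

/-- The factor `1/2` in the exponent is given away, so that Bernoulli's inequality applies with the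
natural exponent `n`. -/
lemma one_sub_rpow_div_le {a b : ℝ} (ha : 0 < a) (hab : a ≤ b) :
    1 - (a / b) ^ ((n : ℝ) / 2) ≤ n * ((b - a) / b) := by
  have hb : 0 < b := ha.trans_le hab
  have h1 : (a / b) ^ (n : ℝ) ≤ (a / b) ^ ((n : ℝ) / 2) := by
    apply Real.rpow_le_rpow_of_exponent_ge (by positivity) ((div_le_one hb).2 hab)
    have : (0 : ℝ) ≤ n := by positivity
    linarith
  have h2 := one_add_mul_le_pow (a := -((b - a) / b)) (by
    have : (b - a) / b ≤ 1 := (div_le_one hb).2 (by linarith)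
    linarith) n
  have h3 : 1 + -((b - a) / b) = a / b := by field_simp; ring
  rw [h3] at h2
  rw [Real.rpow_natCast] at h1
  linarith

end Kernel

/-! ### The heat semigroup: bounds, semigroup law, time regularity -/

section Heat

lemma abs_integral_le_of_abs_le {β : Type*} [MeasurableSpace β] {μ : Measure β} {f g : β → ℝ}
    (hg : Integrable g μ) (h : ∀ᵐ x ∂μ, |f x| ≤ g x) : |∫ x, f x ∂μ| ≤ ∫ x, g x ∂μ :=
  (Real.norm_eq_abs _).symm.trans_le (norm_integral_le_of_norm_le hg h)

variable {n : ℕ} {f g : EuclideanSpace ℝ (Fin n) → ℝ}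

lemma integrable_heatKernel_sub {t : ℝ} (ht : 0 < t) (x : EuclideanSpace ℝ (Fin n)) :
    Integrable (fun y => heatKernel t (x - y)) :=
  (integrable_heatKernel ht).comp_sub_left x

lemma integral_heatKernel_sub {t : ℝ} (ht : 0 < t) (x : EuclideanSpace ℝ (Fin n)) :
    ∫ y, heatKernel t (x - y) = 1 := by
  rw [integral_sub_left_eq_self (fun y => heatKernel t y), integral_heatKernel ht]

lemma integrable_heatKernel_mul {t : ℝ} (ht : 0 < t) (hf : Integrable f)
    (x : EuclideanSpace ℝ (Fin n)) : Integrable (fun y => heatKernel t (x - y) * f y) := by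
  refine hf.bdd_mul (c := (4 * Real.pi * t) ^ (-((n : ℝ) / 2)))
    ((continuous_heatKernel t).comp (by fun_prop : Continuous fun y => x - y)).aestronglyMeasurable
    (.of_forall fun y => ?_)
  rw [Real.norm_eq_abs, abs_of_pos (heatKernel_pos ht _)]
  exact heatKernel_le ht _

lemma heat_congr_ae (t : ℝ) (h : f =ᵐ[volume] g) (x : EuclideanSpace ℝ (Fin n)) :
    heat t f x = heat t g x := by
  refine integral_congr_ae ?_
  filter_upwards [h] with y hy
  rw [hy]

lemma heat_const_mul (t c : ℝ) (f : EuclideanSpace ℝ (Fin n) → ℝ)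
    (x : EuclideanSpace ℝ (Fin n)) : heat t (fun y => c * f y) x = c * heat t f x := by
  unfold heat
  rw [← integral_const_mul]
  congr 1
  ext y
  ring

lemma heat_sub {t : ℝ} (ht : 0 < t) (hf : Integrable f) (hg : Integrable g)
    (x : EuclideanSpace ℝ (Fin n)) :
    heat t (fun y => f y - g y) x = heat t f x - heat t g x := by
  unfold heat
  rw [← integral_sub (integrable_heatKernel_mul ht hf x) (integrable_heatKernel_mul ht hg x)]
  congr 1
  ext y
  ring

lemma heat_nonneg {t : ℝ} (ht : 0 < t) (hf : ∀ y, 0 ≤ f y) (x : EuclideanSpace ℝ (Fin n)) :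
    0 ≤ heat t f x :=
  integral_nonneg fun y => mul_nonneg (heatKernel_pos ht _).le (hf y)

lemma abs_heat_le {t : ℝ} (ht : 0 < t) (hg : Integrable g) (h : ∀ᵐ y, |f y| ≤ g y)
    (x : EuclideanSpace ℝ (Fin n)) : |heat t f x| ≤ heat t g x := by
  refine abs_integral_le_of_abs_le (integrable_heatKernel_mul ht hg x) ?_
  filter_upwards [h] with y hy
  rw [abs_mul, abs_of_pos (heatKernel_pos ht _)]
  exact mul_le_mul_of_nonneg_left hy (heatKernel_pos ht _).le

lemma abs_heat_le_const {t M : ℝ} (ht : 0 < t) (h : ∀ᵐ y, |f y| ≤ M)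
    (x : EuclideanSpace ℝ (Fin n)) : |heat t f x| ≤ M := by
  have := abs_integral_le_of_abs_le (f := fun y => heatKernel t (x - y) * f y)
    (g := fun y => heatKernel t (x - y) * M) ((integrable_heatKernel_sub ht x).mul_const M) (by
      filter_upwards [h] with y hy
      rw [abs_mul, abs_of_pos (heatKernel_pos ht _)]
      exact mul_le_mul_of_nonneg_left hy (heatKernel_pos ht _).le)
  rwa [integral_mul_const, integral_heatKernel_sub ht, one_mul] at this

lemma abs_heat_le_decay {t : ℝ} (ht : 0 < t) (hf : Integrable f)
    (x : EuclideanSpace ℝ (Fin n)) :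
    |heat t f x| ≤ (4 * Real.pi * t) ^ (-((n : ℝ) / 2)) * ∫ y, |f y| := by
  rw [← integral_const_mul]
  refine abs_integral_le_of_abs_le (hf.abs.const_mul _) (.of_forall fun y => ?_)
  rw [abs_mul, abs_of_pos (heatKernel_pos ht _)]
  exact mul_le_mul_of_nonneg_right (heatKernel_le ht _) (abs_nonneg _)

lemma heat_eq_convolution (t : ℝ) (f : EuclideanSpace ℝ (Fin n) → ℝ) :
    heat t f = convolution f (heatKernel t) (ContinuousLinearMap.mul ℝ ℝ) volume := by
  ext x
  simp only [heat, convolution, ContinuousLinearMap.mul_apply']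
  congr 1
  ext y
  ring

lemma integrable_heat {t : ℝ} (ht : 0 < t) (hf : Integrable f) : Integrable (heat t f) := by
  rw [heat_eq_convolution]
  exact hf.integrable_convolution _ (integrable_heatKernel ht)

lemma integral_heat {t : ℝ} (ht : 0 < t) (hf : Integrable f) : ∫ x, heat t f x = ∫ x, f x := by
  rw [heat_eq_convolution, integral_convolution _ hf (integrable_heatKernel ht),
    integral_heatKernel ht]
  simp

lemma heat_heat {s t : ℝ} (hs : 0 < s) (ht : 0 < t) (hf : Integrable f)
    (x : EuclideanSpace ℝ (Fin n)) : heat s (heat t f) x = heat (s + t) f x := by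
  have hint : Integrable (Function.uncurry fun y z =>
      heatKernel s (x - y) * (heatKernel t (y - z) * f z)) (volume.prod volume) := by
    have h := hf.convolution_integrand (ContinuousLinearMap.mul ℝ ℝ)
      (integrable_heatKernel (n := n) ht) (μ := volume)
    refine (h.bdd_mul (f := fun q => heatKernel s (x - q.1))
      (c := (4 * Real.pi * s) ^ (-((n : ℝ) / 2)))
      ((continuous_heatKernel s).comp (by fun_prop)).aestronglyMeasurable
      (.of_forall fun y => ?_)).congr (.of_forall fun q => ?_)
    · rw [Real.norm_eq_abs, abs_of_pos (heatKernel_pos hs _)]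
      exact heatKernel_le hs _
    · simp only [ContinuousLinearMap.mul_apply', Function.uncurry]
      ring
  unfold heat
  simp_rw [← integral_const_mul]
  rw [integral_integral_swap hint]
  congr 1
  ext z
  simp_rw [← mul_assoc]
  rw [integral_mul_const]
  congr 1
  rw [← integral_heatKernel_mul_heatKernel hs ht (x - z),
    ← integral_sub_right_eq_self (fun y => heatKernel s (x - z - y) * heatKernel t y) z]
  simp

lemma measurable_heat_param {β : Type*} [MeasurableSpace β] {s : β → ℝ}
    {X : β → EuclideanSpace ℝ (Fin n)} {F : β × EuclideanSpace ℝ (Fin n) → ℝ}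
    (hs : Measurable s) (hX : Measurable X) (hF : Measurable F) :
    Measurable fun b => heat (s b) (fun y => F (b, y)) (X b) := by
  unfold heat
  refine (StronglyMeasurable.integral_prod_right'
    (f := fun q : β × EuclideanSpace ℝ (Fin n) => heatKernel (s q.1) (X q.1 - q.2) * F q)
    (Measurable.stronglyMeasurable ?_)).measurable
  exact (measurable_heatKernel.comp (by fun_prop : Measurable
    fun q : β × EuclideanSpace ℝ (Fin n) => (s q.1, X q.1 - q.2))).mul hF

/-- Write `|d| = d + 2d⁻`. By `heatKernel_mono` the negative part of the difference is only a small
multiple of the earlier kernel. The signed part is kept because it integrates to zero, both kernels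
having mass one. -/
lemma abs_heatKernel_sub_le {a b : ℝ} (ha : 0 < a) (hab : a ≤ b)
    (x : EuclideanSpace ℝ (Fin n)) :
    |heatKernel b x - heatKernel a x| ≤
      heatKernel b x - heatKernel a x + 2 * n * ((b - a) / b) * heatKernel a x := by
  have h1 := heatKernel_mono ha hab x
  have h2 : (1 - (a / b) ^ ((n : ℝ) / 2)) * heatKernel a x ≤
      n * ((b - a) / b) * heatKernel a x :=
    mul_le_mul_of_nonneg_right (one_sub_rpow_div_le ha hab) (heatKernel_pos ha x).le
  have hb : 0 < b := ha.trans_le hab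
  have h3 : 0 ≤ n * ((b - a) / b) * heatKernel a x :=
    mul_nonneg (mul_nonneg (by positivity) (div_nonneg (by linarith) hb.le))
      (heatKernel_pos ha x).le
  rw [abs_le]
  constructor <;> linarith

lemma heat_sub_heat {a b : ℝ} (ha : 0 < a) (hb : 0 < b) (hf : Integrable f)
    (x : EuclideanSpace ℝ (Fin n)) :
    heat b f x - heat a f x = ∫ y, (heatKernel b (x - y) - heatKernel a (x - y)) * f y := by
  unfold heat
  rw [← integral_sub (integrable_heatKernel_mul hb hf x) (integrable_heatKernel_mul ha hf x)]
  congr 1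
  ext y
  ring

/-- Time regularity of the heat flow of a function that is dominated by an integrable one. -/
lemma abs_heat_sub_heat_le {a b : ℝ} (ha : 0 < a) (hab : a ≤ b) (hf : Integrable f)
    (hg : Integrable g) (h : ∀ᵐ y, |f y| ≤ g y) (x : EuclideanSpace ℝ (Fin n)) :
    |heat b f x - heat a f x| ≤
      heat b g x - heat a g x + 2 * n * ((b - a) / b) * heat a g x := by
  have hb : 0 < b := ha.trans_le hab
  have hia := integrable_heatKernel_mul ha hg x
  have hib := integrable_heatKernel_mul hb hg x
  have hsub : Integrable (fun y => heatKernel b (x - y) * g y - heatKernel a (x - y) * g y) :=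
    hib.sub hia
  rw [heat_sub_heat ha hb hf]
  refine (abs_integral_le_of_abs_le ((hib.sub hia).add
    (hia.const_mul (2 * n * ((b - a) / b)))) ?_).trans_eq ?_
  · filter_upwards [h] with y hy
    rw [abs_mul]
    refine (mul_le_mul (abs_heatKernel_sub_le ha hab (x - y)) hy (abs_nonneg _)
      ((abs_nonneg _).trans (abs_heatKernel_sub_le ha hab (x - y)))).trans_eq ?_
    simp only [Pi.add_apply, Pi.sub_apply]
    ring
  · simp only [Pi.add_apply, Pi.sub_apply]
    rw [integral_add hsub (hia.const_mul _), integral_sub hib hia, integral_const_mul]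
    rfl

lemma abs_heat_sub_heat_le_const {a b M : ℝ} (ha : 0 < a) (hab : a ≤ b) (hf : Integrable f)
    (h : ∀ᵐ y, |f y| ≤ M) (x : EuclideanSpace ℝ (Fin n)) :
    |heat b f x - heat a f x| ≤ 2 * n * ((b - a) / b) * M := by
  have hb : 0 < b := ha.trans_le hab
  have hia := integrable_heatKernel_sub ha x
  have hib := integrable_heatKernel_sub hb x
  have hsub : Integrable (fun y => heatKernel b (x - y) - heatKernel a (x - y)) := hib.sub hia
  rw [heat_sub_heat ha hb hf]
  refine (abs_integral_le_of_abs_le (((hib.sub hia).add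
    (hia.const_mul (2 * n * ((b - a) / b)))).mul_const M) ?_).trans_eq ?_
  · filter_upwards [h] with y hy
    rw [abs_mul]
    exact mul_le_mul (abs_heatKernel_sub_le ha hab (x - y)) hy (abs_nonneg _)
      ((abs_nonneg _).trans (abs_heatKernel_sub_le ha hab (x - y)))
  · rw [integral_mul_const]
    simp only [Pi.add_apply, Pi.sub_apply]
    rw [integral_add hsub (hia.const_mul _), integral_sub hib hia, integral_const_mul,
      integral_heatKernel_sub ha, integral_heatKernel_sub hb]
    ring

lemma tendsto_eLpNorm_translate (hf : MemLp f 1 volume) :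
    Tendsto (fun z : EuclideanSpace ℝ (Fin n) => eLpNorm (fun x => f (x - z) - f x) 1 volume)
      (𝓝 0) (𝓝 0) := by
  let G : C(EuclideanSpace ℝ (Fin n), C(EuclideanSpace ℝ (Fin n), EuclideanSpace ℝ (Fin n))) :=
    (ContinuousMap.mk (fun a : EuclideanSpace ℝ (Fin n) × EuclideanSpace ℝ (Fin n) =>
      a.2 - a.1) (by fun_prop)).curry
  have hG : ∀ z, MeasurePreserving (G z) volume volume := fun z =>
    measurePreserving_sub_right volume z
  have h := (continuousAt_const (x := (0 : EuclideanSpace ℝ (Fin n)))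
    (y := MemLp.toLp f hf)).compMeasurePreservingLp
    G.continuous.continuousAt hG (by simp)
  simp only [ContinuousAt, Lp.toLp_compMeasurePreserving] at h
  rw [Lp.tendsto_Lp_iff_tendsto_eLpNorm''] at h
  have h0 : f ∘ (G 0) = f := by
    ext x
    simp [G]
  rw [h0] at h
  exact h

/-- The substitution `y = x - √t z` exhibits the heat flow as an average of translates of `f`
against a fixed Gaussian. -/
lemma heat_eq_integral_scaled {t : ℝ} (ht : 0 < t) (f : EuclideanSpace ℝ (Fin n) → ℝ)
    (x : EuclideanSpace ℝ (Fin n)) :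
    heat t f x = ∫ z, heatKernel 1 z * f (x - √t • z) := by
  have hst : 0 < √t := Real.sqrt_pos.2 ht
  have h1 : ∀ z : EuclideanSpace ℝ (Fin n), heatKernel 1 z * f (x - √t • z) =
      (√t ^ n) * (heatKernel t (√t • z) * f (x - √t • z)) := by
    intro z
    have : heatKernel 1 z = √t ^ n * heatKernel t (√t • z) := by
      have hpi := Real.pi_pos
      unfold heatKernel
      rw [norm_smul, mul_pow, Real.norm_eq_abs, sq_abs, Real.sq_sqrt ht.le, ← mul_assoc]
      congr 1
      · rw [Real.mul_rpow (by positivity) ht.le, Real.rpow_neg ht.le, mul_one,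
          Real.sqrt_eq_rpow, ← Real.rpow_natCast, ← Real.rpow_mul ht.le]
        rw [show (1 : ℝ) / 2 * n = n / 2 by ring]
        have : t ^ ((n : ℝ) / 2) ≠ 0 := by positivity
        field_simp
      · congr 2
        field_simp
    rw [this, mul_assoc]
  simp_rw [h1]
  rw [integral_const_mul, Measure.integral_comp_smul volume
    (fun z => heatKernel t z * f (x - z)) (√t), finrank_euclideanSpace_fin,
    abs_of_pos (by positivity), smul_eq_mul, ← mul_assoc, mul_inv_cancel₀ (by positivity), one_mul]
  unfold heat
  rw [← integral_sub_left_eq_self (fun y => heatKernel t (x - y) * f y) volume x]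
  simp

/-- The heat semigroup is strongly continuous at time zero in `L¹`. -/
lemma tendsto_eLpNorm_heat_sub (hfm : Measurable f) (hf : Integrable f) :
    Tendsto (fun t => eLpNorm (fun x => heat t f x - f x) 1 volume) (𝓝[>] 0) (𝓝 0) := by
  set φ : EuclideanSpace ℝ (Fin n) → ℝ≥0∞ := fun z =>
    eLpNorm (fun x => f (x - z) - f x) 1 volume with hφ
  have hφm : Measurable φ := by
    simp only [hφ, eLpNorm_one_eq_lintegral_enorm]
    exact Measurable.lintegral_prod_right
      (f := fun z x : EuclideanSpace ℝ (Fin n) => ‖f (x - z) - f x‖ₑ)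
      (by simp only [Function.uncurry_def]; fun_prop)
  have hf1 : MemLp f 1 volume := memLp_one_iff_integrable.2 hf
  have hφle : ∀ z, φ z ≤ 2 * eLpNorm f 1 volume := by
    intro z
    have hmp := measurePreserving_sub_right (volume : Measure (EuclideanSpace ℝ (Fin n))) z
    have h := eLpNorm_sub_le (p := 1) (f := f ∘ fun x => x - z) (g := f)
      (hfm.comp hmp.measurable).aestronglyMeasurable hfm.aestronglyMeasurable
      (μ := volume) le_rfl
    rw [eLpNorm_comp_measurePreserving hfm.aestronglyMeasurable hmp, ← two_mul] at h
    exact h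
  -- Minkowski's inequality via Tonelli: the `L¹` error is at most the Gaussian average of the
  -- translation errors `φ (√t • z)`. These are bounded by twice the norm of `f` and tend to zero,
  -- so dominated convergence applies.
  have hle : ∀ t : ℝ, 0 < t → eLpNorm (fun x => heat t f x - f x) 1 volume ≤
      ∫⁻ z, ENNReal.ofReal (heatKernel 1 z) * φ (√t • z) := by
    intro t ht
    have hst : √t ≠ 0 := (Real.sqrt_pos.2 ht).ne'
    have hpt : ∀ x, heat t f x - f x =
        ∫ z, heatKernel 1 z * (f (x - √t • z) - f x) := by
      intro x
      have hi : Integrable (fun z => heatKernel 1 z * f (x - √t • z)) :=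
        ((hf.comp_sub_left x).comp_smul hst).bdd_mul (c := (4 * Real.pi * 1) ^ (-((n : ℝ) / 2)))
          (continuous_heatKernel 1).aestronglyMeasurable (.of_forall fun y => by
            rw [Real.norm_eq_abs, abs_of_pos (heatKernel_pos one_pos _)]
            exact heatKernel_le one_pos _)
      simp_rw [mul_sub]
      rw [integral_sub hi ((integrable_heatKernel one_pos).mul_const _), integral_mul_const,
        integral_heatKernel one_pos, one_mul, heat_eq_integral_scaled ht]
    rw [eLpNorm_one_eq_lintegral_enorm]
    calc ∫⁻ x, ‖heat t f x - f x‖ₑ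
        ≤ ∫⁻ x, ∫⁻ z, ‖heatKernel 1 z * (f (x - √t • z) - f x)‖ₑ := by
          refine lintegral_mono fun x => ?_
          rw [hpt]
          exact enorm_integral_le_lintegral_enorm _
      _ = ∫⁻ z, ∫⁻ x, ‖heatKernel 1 z * (f (x - √t • z) - f x)‖ₑ := by
          refine lintegral_lintegral_swap (Measurable.aemeasurable ?_)
          have := (continuous_heatKernel (n := n) 1).measurable
          simp only [Function.uncurry_def]
          fun_prop
      _ = ∫⁻ z, ENNReal.ofReal (heatKernel 1 z) * φ (√t • z) := by
          refine lintegral_congr fun z => ?_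
          simp_rw [enorm_mul]
          rw [lintegral_const_mul _ (by fun_prop), Real.enorm_of_nonneg
            (heatKernel_pos one_pos z).le]
          simp only [hφ, eLpNorm_one_eq_lintegral_enorm]
  have hlim : Tendsto (fun t : ℝ => ∫⁻ z, ENNReal.ofReal (heatKernel 1 z) * φ (√t • z))
      (𝓝[>] 0) (𝓝 (∫⁻ z : EuclideanSpace ℝ (Fin n), 0)) := by
    refine tendsto_lintegral_filter_of_dominated_convergence
      (fun z => ENNReal.ofReal (heatKernel 1 z) * (2 * eLpNorm f 1 volume)) ?_ ?_ ?_ ?_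
    · refine .of_forall fun t => ?_
      have := (continuous_heatKernel (n := n) 1).measurable
      fun_prop
    · exact .of_forall fun t => .of_forall fun z => by gcongr; exact hφle _
    · rw [lintegral_mul_const _ (by
        have := (continuous_heatKernel (n := n) 1).measurable
        fun_prop), ← ofReal_integral_eq_lintegral_ofReal (integrable_heatKernel one_pos)
          (.of_forall fun z => (heatKernel_pos one_pos z).le)]
      exact ENNReal.mul_ne_top ENNReal.ofReal_ne_top (ENNReal.mul_ne_top (by simp) hf1.2.ne)
    · refine .of_forall fun z => ?_
      have h1 : Tendsto (fun t : ℝ => √t • z) (𝓝[>] 0) (𝓝 0) := by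
        have : Tendsto (fun t : ℝ => √t • z) (𝓝 0) (𝓝 (√0 • z)) :=
          (Continuous.smul Real.continuous_sqrt continuous_const).tendsto 0
        simp only [Real.sqrt_zero, zero_smul] at this
        exact this.mono_left nhdsWithin_le_nhds
      have h2 := ENNReal.Tendsto.const_mul ((tendsto_eLpNorm_translate hf1).comp h1)
        (a := ENNReal.ofReal (heatKernel 1 z)) (Or.inr ENNReal.ofReal_ne_top)
      rw [mul_zero] at h2
      exact h2
  rw [lintegral_zero] at hlim
  refine tendsto_of_tendsto_of_tendsto_of_le_of_le' tendsto_const_nhds hlim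
    (.of_forall fun _ => zero_le) ?_
  filter_upwards [self_mem_nhdsWithin] with t ht using hle t ht

end Heat

/-! ### The Duhamel integral -/

section Duhamel

variable {n : ℕ}

/-- The Duhamel integral `∫₀ᵗ e^{(t-τ)Δ} F(τ) dτ`. -/
def duhamelIntegral (F : ℝ → EuclideanSpace ℝ (Fin n) → ℝ) (t : ℝ)
    (x : EuclideanSpace ℝ (Fin n)) : ℝ :=
  ∫ τ in (0 : ℝ)..t, heat (t - τ) (F τ) x

variable {F : ℝ → EuclideanSpace ℝ (Fin n) → ℝ} {w : EuclideanSpace ℝ (Fin n) → ℝ}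

lemma measurable_duhamelIntegral (hF : Measurable (Function.uncurry F)) :
    Measurable (Function.uncurry (duhamelIntegral F)) := by
  have hG : Measurable fun q : (ℝ × EuclideanSpace ℝ (Fin n)) × ℝ =>
      heat (q.1.1 - q.2) (F q.2) q.1.2 :=
    measurable_heat_param (F := fun r : ((ℝ × EuclideanSpace ℝ (Fin n)) × ℝ) ×
      EuclideanSpace ℝ (Fin n) => F r.1.2 r.2) (by fun_prop) (by fun_prop)
      (hF.comp (by fun_prop : Measurable fun r : ((ℝ × EuclideanSpace ℝ (Fin n)) × ℝ) ×
        EuclideanSpace ℝ (Fin n) => (r.1.2, r.2)))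
  -- An interval integral is a difference of two integrals over `Ioc`, one of which is empty
  -- depending on the sign of `t`; both must be measurable in their endpoints.
  have hset : ∀ a b : ℝ × EuclideanSpace ℝ (Fin n) → ℝ, Measurable a → Measurable b →
      Measurable fun q => ∫ τ in Set.Ioc (a q) (b q), heat (q.1 - τ) (F τ) q.2 := by
    intro a b ha hb
    simp_rw [← integral_indicator measurableSet_Ioc]
    refine (StronglyMeasurable.integral_prod_right'
      (f := fun q : (ℝ × EuclideanSpace ℝ (Fin n)) × ℝ =>
        {q : (ℝ × EuclideanSpace ℝ (Fin n)) × ℝ | a q.1 < q.2 ∧ q.2 ≤ b q.1}.indicator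
          (fun q => heat (q.1.1 - q.2) (F q.2) q.1.2) q)
      (Measurable.stronglyMeasurable ?_)).measurable
    refine hG.indicator ?_
    exact (measurableSet_lt (ha.comp measurable_fst) measurable_snd).inter
      (measurableSet_le measurable_snd (hb.comp measurable_fst))
  exact (hset (fun _ => 0) (fun q => q.1) measurable_const measurable_fst).sub
    (hset (fun q => q.1) (fun _ => 0) measurable_fst measurable_const)

/-- The semigroup law makes the resulting bound at time `s + τ` use the same `w`; hence in a Duhamel
integral `e^{tΔ}w` can be pulled out. -/
lemma abs_heat_le_mul_heat (hw : Integrable w) {f : EuclideanSpace ℝ (Fin n) → ℝ} {s τ c : ℝ}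
    (hs : 0 < s) (hτ : 0 < τ) (h : ∀ y, |f y| ≤ c * heat τ w y)
    (x : EuclideanSpace ℝ (Fin n)) : |heat s f x| ≤ c * heat (s + τ) w x := by
  refine (abs_heat_le hs ((integrable_heat hτ hw).const_mul c) (.of_forall h) x).trans_eq ?_
  rw [heat_const_mul, heat_heat hs hτ hw]

lemma abs_heat_le_of_mem_Ioo (hw : Integrable w) {g : ℝ → ℝ} {t : ℝ}
    (h : ∀ τ ∈ Set.Ioo 0 t, ∀ y, |F τ y| ≤ g τ * heat τ w y)
    (x : EuclideanSpace ℝ (Fin n)) :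
    ∀ τ ∈ Set.Ioo 0 t, |heat (t - τ) (F τ) x| ≤ g τ * heat t w x := by
  intro τ hτ
  have := abs_heat_le_mul_heat hw (sub_pos.2 hτ.2) hτ.1 (h τ hτ) x
  rwa [sub_add_cancel] at this

lemma abs_duhamelIntegral_le (hw : Integrable w) {g : ℝ → ℝ} {t : ℝ} (ht : 0 ≤ t)
    (hg : IntervalIntegrable g volume 0 t)
    (h : ∀ τ ∈ Set.Ioo 0 t, ∀ y, |F τ y| ≤ g τ * heat τ w y)
    (x : EuclideanSpace ℝ (Fin n)) :
    |duhamelIntegral F t x| ≤ (∫ τ in (0 : ℝ)..t, g τ) * heat t w x := by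
  rw [← intervalIntegral.integral_mul_const]
  rw [← Real.norm_eq_abs, duhamelIntegral]
  refine intervalIntegral.norm_integral_le_of_norm_le ht ?_ (hg.mul_const _)
  filter_upwards [Measure.ae_ne volume t] with τ hne hτ
  exact abs_heat_le_of_mem_Ioo hw h x τ ⟨hτ.1, lt_of_le_of_ne hτ.2 hne⟩

lemma intervalIntegrable_heat (hF : Measurable (Function.uncurry F)) (hw : Integrable w)
    {g : ℝ → ℝ} {t : ℝ} (ht : 0 ≤ t) (hg : IntervalIntegrable g volume 0 t)
    (h : ∀ τ ∈ Set.Ioo 0 t, ∀ y, |F τ y| ≤ g τ * heat τ w y)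
    (x : EuclideanSpace ℝ (Fin n)) :
    IntervalIntegrable (fun τ => heat (t - τ) (F τ) x) volume 0 t := by
  refine (hg.mul_const (heat t w x)).mono_fun' ?_ ?_
  · exact (measurable_heat_param (F := fun r : ℝ × EuclideanSpace ℝ (Fin n) => F r.1 r.2)
      (by fun_prop) (by fun_prop) hF).aestronglyMeasurable
  · rw [Set.uIoc_of_le ht]
    filter_upwards [ae_restrict_mem measurableSet_Ioc,
      ae_restrict_of_ae (Measure.ae_ne volume t)] with τ hτ hne
    exact abs_heat_le_of_mem_Ioo hw h x τ ⟨hτ.1, lt_of_le_of_ne hτ.2 hne⟩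

lemma duhamelIntegral_sub {G : ℝ → EuclideanSpace ℝ (Fin n) → ℝ} {t : ℝ} (ht : 0 ≤ t)
    (hFi : ∀ τ ∈ Set.Ioo 0 t, Integrable (F τ)) (hGi : ∀ τ ∈ Set.Ioo 0 t, Integrable (G τ))
    (x : EuclideanSpace ℝ (Fin n))
    (hF : IntervalIntegrable (fun τ => heat (t - τ) (F τ) x) volume 0 t)
    (hG : IntervalIntegrable (fun τ => heat (t - τ) (G τ) x) volume 0 t) :
    duhamelIntegral F t x - duhamelIntegral G t x =
      duhamelIntegral (fun τ y => F τ y - G τ y) t x := by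
  unfold duhamelIntegral
  rw [← intervalIntegral.integral_sub hF hG]
  refine intervalIntegral.integral_congr_ae ?_
  filter_upwards [Measure.ae_ne volume t] with τ hne hτ
  rw [Set.uIoc_of_le ht] at hτ
  have hτ' : τ ∈ Set.Ioo 0 t := ⟨hτ.1, lt_of_le_of_ne hτ.2 hne⟩
  exact (heat_sub (sub_pos.2 hτ'.2) (hFi τ hτ') (hGi τ hτ') x).symm

end Duhamel

/-- Mean value inequality for `x ^ p` on `[0, M]`; this is where `p ≥ 1` enters. -/
lemma abs_rpow_sub_rpow_le {p M a b : ℝ} (hp : 1 ≤ p) (ha : |a| ≤ M) (hb : |b| ≤ M) :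
    |(|a| ^ p - |b| ^ p)| ≤ p * M ^ (p - 1) * |a - b| := by
  have h := Convex.norm_image_sub_le_of_norm_hasDerivWithin_le (f := fun x : ℝ => x ^ p)
    (f' := fun x => p * x ^ (p - 1)) (s := Set.Icc 0 M) (C := p * M ^ (p - 1)) (x := |b|)
    (y := |a|) (fun x _ => (Real.hasDerivAt_rpow_const (Or.inr hp)).hasDerivWithinAt)
    (fun x hx => by
      rw [Real.norm_eq_abs, abs_of_nonneg (mul_nonneg (by linarith) (Real.rpow_nonneg hx.1 _))]
      exact mul_le_mul_of_nonneg_left (Real.rpow_le_rpow hx.1 hx.2 (by linarith)) (by linarith))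
    (convex_Icc 0 M) ⟨abs_nonneg b, hb⟩ ⟨abs_nonneg a, ha⟩
  refine h.trans ?_
  have hM : 0 ≤ M := (abs_nonneg a).trans ha
  exact mul_le_mul_of_nonneg_left (abs_abs_sub_abs_le a b)
    (mul_nonneg (by linarith) (Real.rpow_nonneg hM _))

/-! ### Supersolutions and Picard iteration -/

section Picard

variable {n k : ℕ}

/-- The function `u` is measurable and bounded by the multiple `h t` of the heat flow of `w`. -/
structure Dominated (w : EuclideanSpace ℝ (Fin n) → ℝ) (h : Fin k → ℝ → ℝ) (T : ℝ)
    (u : Fin k → ℝ → EuclideanSpace ℝ (Fin n) → ℝ) : Prop where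
  measurable : ∀ j, Measurable (Function.uncurry (u j))
  bound : ∀ j, ∀ t ∈ Set.Ioc 0 T, ∀ x, |u j t x| ≤ h j t * heat t w x

lemma Dominated.measurable_rpow {w : EuclideanSpace ℝ (Fin n) → ℝ} {h : Fin k → ℝ → ℝ}
    {T : ℝ} {u : Fin k → ℝ → EuclideanSpace ℝ (Fin n) → ℝ} (hu : Dominated w h T u)
    (p : Fin k → ℝ) (i j : Fin k) :
    Measurable (Function.uncurry fun τ y => |u i τ y| ^ p j) := by
  have := hu.measurable i
  simp only [Function.uncurry_def] at this ⊢
  fun_prop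

variable [NeZero k]

/-- The map whose fixed points are the solutions of the integral equation. -/
def picard (p : Fin k → ℝ) (u₀ : Fin k → EuclideanSpace ℝ (Fin n) → ℝ)
    (u : Fin k → ℝ → EuclideanSpace ℝ (Fin n) → ℝ) (j : Fin k) (t : ℝ)
    (x : EuclideanSpace ℝ (Fin n)) : ℝ :=
  heat t (u₀ j) x + duhamelIntegral (fun τ y => |u (j + 1) τ y| ^ p j) t x

/-- Amplitudes `h` for which `h t e^{tΔ} w` is a supersolution on `[0, T]`. -/
structure Supersolution (p : Fin k → ℝ) (u₀ : Fin k → EuclideanSpace ℝ (Fin n) → ℝ)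
    (w : EuclideanSpace ℝ (Fin n) → ℝ) (h : Fin k → ℝ → ℝ) (m : ℝ → ℝ) (T : ℝ) : Prop where
  one_le : ∀ j, 1 ≤ p j
  measurable_init : ∀ j, Measurable (u₀ j)
  abs_init_le : ∀ j x, |u₀ j x| ≤ w x
  integrable : Integrable w
  continuous_h : ∀ j, Continuous (h j)
  continuous_m : Continuous m
  h_nonneg : ∀ j t, 0 ≤ h j t
  m_pos : ∀ t, 0 < m t
  heat_le : ∀ t ∈ Set.Ioc 0 T, ∀ x, heat t w x ≤ m t
  super : ∀ j, ∀ t ∈ Set.Ioc 0 T,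
    1 + ∫ τ in (0 : ℝ)..t, h (j + 1) τ ^ p j * m τ ^ (p j - 1) ≤ h j t

variable {p : Fin k → ℝ} {u₀ : Fin k → EuclideanSpace ℝ (Fin n) → ℝ}
  {w : EuclideanSpace ℝ (Fin n) → ℝ} {h : Fin k → ℝ → ℝ} {m : ℝ → ℝ} {T : ℝ}
  {u v : Fin k → ℝ → EuclideanSpace ℝ (Fin n) → ℝ}

lemma Supersolution.w_nonneg (hS : Supersolution p u₀ w h m T) (x : EuclideanSpace ℝ (Fin n)) :
    0 ≤ w x := (abs_nonneg _).trans (hS.abs_init_le 0 x)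

lemma Supersolution.heat_nonneg (hS : Supersolution p u₀ w h m T) {t : ℝ} (ht : 0 < t)
    (x : EuclideanSpace ℝ (Fin n)) : 0 ≤ heat t w x :=
  HeatSystem.heat_nonneg ht hS.w_nonneg x

lemma Supersolution.integrable_init (hS : Supersolution p u₀ w h m T) (j : Fin k) :
    Integrable (u₀ j) :=
  hS.integrable.mono' (hS.measurable_init j).aestronglyMeasurable
    (.of_forall (hS.abs_init_le j))

lemma Supersolution.continuous_amp (hS : Supersolution p u₀ w h m T) (j : Fin k) :
    Continuous fun τ => h (j + 1) τ ^ p j * m τ ^ (p j - 1) :=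
  ((hS.continuous_h _).rpow_const fun _ => Or.inr (by linarith [hS.one_le j])).mul
    (hS.continuous_m.rpow_const fun t => Or.inl (hS.m_pos t).ne')

/-- Of the `p j` powers of `e^{τΔ}w`, one is kept for the semigroup law and the remaining `p j - 1`
are estimated by `m τ`. -/
lemma Dominated.rpow_le (hu : Dominated w h T u) (hS : Supersolution p u₀ w h m T) (j : Fin k)
    {τ : ℝ} (hτ : τ ∈ Set.Ioc 0 T) (y : EuclideanSpace ℝ (Fin n)) :
    |(|u (j + 1) τ y| ^ p j)| ≤ h (j + 1) τ ^ p j * m τ ^ (p j - 1) * heat τ w y := by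
  have hW := hS.heat_nonneg hτ.1 y
  have hp := hS.one_le j
  rw [abs_of_nonneg (by positivity)]
  calc |u (j + 1) τ y| ^ p j ≤ (h (j + 1) τ * heat τ w y) ^ p j :=
        Real.rpow_le_rpow (abs_nonneg _) (hu.bound _ τ hτ y) (by linarith)
    _ = h (j + 1) τ ^ p j * (heat τ w y ^ (p j - 1) * heat τ w y) := by
        rw [Real.mul_rpow (hS.h_nonneg _ _) hW]
        congr 1
        conv_rhs => rw [← Real.rpow_one (heat τ w y), ← Real.rpow_mul hW, one_mul,
          ← Real.rpow_add_of_nonneg hW (by linarith) zero_le_one]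
        congr 1
        ring
    _ ≤ h (j + 1) τ ^ p j * (m τ ^ (p j - 1) * heat τ w y) := by
        refine mul_le_mul_of_nonneg_left (mul_le_mul_of_nonneg_right ?_ hW)
          (Real.rpow_nonneg (hS.h_nonneg _ _) _)
        exact Real.rpow_le_rpow hW (hS.heat_le τ hτ y) (by linarith)
    _ = _ := by ring

lemma Dominated.integrable_rpow (hu : Dominated w h T u) (hS : Supersolution p u₀ w h m T)
    (j : Fin k) {τ : ℝ} (hτ : τ ∈ Set.Ioc 0 T) :
    Integrable fun y => |u (j + 1) τ y| ^ p j :=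
  ((integrable_heat hτ.1 hS.integrable).const_mul _).mono'
    ((hu.measurable_rpow p (j + 1) j).comp measurable_prodMk_left).aestronglyMeasurable
    (.of_forall (hu.rpow_le hS j hτ))

lemma Dominated.intervalIntegrable (hu : Dominated w h T u) (hS : Supersolution p u₀ w h m T)
    (j : Fin k) {t : ℝ} (ht : t ∈ Set.Ioc 0 T) (x : EuclideanSpace ℝ (Fin n)) :
    IntervalIntegrable (fun τ => heat (t - τ) (fun y => |u (j + 1) τ y| ^ p j) x) volume 0 t :=
  intervalIntegrable_heat (hu.measurable_rpow p (j + 1) j) hS.integrable ht.1.le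
    ((hS.continuous_amp j).intervalIntegrable _ _)
    (fun _ hτ => hu.rpow_le hS j ⟨hτ.1, hτ.2.le.trans ht.2⟩) x

lemma Dominated.picard (hu : Dominated w h T u) (hS : Supersolution p u₀ w h m T) :
    Dominated w h T (picard p u₀ u) where
  measurable j := by
    have h1 := measurable_duhamelIntegral (hu.measurable_rpow p (j + 1) j)
    have h2 : Measurable fun q : ℝ × EuclideanSpace ℝ (Fin n) => heat q.1 (u₀ j) q.2 :=
      measurable_heat_param (F := fun r : (ℝ × EuclideanSpace ℝ (Fin n)) ×
        EuclideanSpace ℝ (Fin n) => u₀ j r.2) (by fun_prop) (by fun_prop)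
        ((hS.measurable_init j).comp measurable_snd)
    exact h2.add h1
  bound j t ht x := by
    have h1 := abs_heat_le ht.1 hS.integrable (.of_forall (hS.abs_init_le j)) x
    have h2 := abs_duhamelIntegral_le hS.integrable ht.1.le
      ((hS.continuous_amp j).intervalIntegrable 0 t)
      (fun τ hτ => hu.rpow_le hS j ⟨hτ.1, hτ.2.le.trans ht.2⟩) x
    calc _ ≤ heat t w x + _ := (abs_add_le _ _).trans (add_le_add h1 h2)
      _ = (1 + ∫ τ in (0 : ℝ)..t, h (j + 1) τ ^ p j * m τ ^ (p j - 1)) * heat t w x := by ring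
      _ ≤ _ := mul_le_mul_of_nonneg_right (hS.super j t ht) (hS.heat_nonneg ht.1 x)

lemma Supersolution.exists_bound (hS : Supersolution p u₀ w h m T) :
    ∃ M, ∀ j, ∀ t ∈ Set.Ioc 0 T, h j t ≤ M ∧ h j t * m t ≤ M := by
  have h1 : ∀ j, ∃ M, ∀ t ∈ Set.Icc 0 T, h j t ≤ M ∧ h j t * m t ≤ M := by
    intro j
    obtain ⟨A, hA⟩ := isCompact_Icc.bddAbove_image
      ((hS.continuous_h j).continuousOn (s := Set.Icc 0 T))
    obtain ⟨B, hB⟩ := isCompact_Icc.bddAbove_image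
      (((hS.continuous_h j).mul hS.continuous_m).continuousOn (s := Set.Icc 0 T))
    refine ⟨max A B, fun t ht => ⟨?_, ?_⟩⟩
    · exact (hA (Set.mem_image_of_mem _ ht)).trans (le_max_left _ _)
    · exact (hB (Set.mem_image_of_mem _ ht)).trans (le_max_right _ _)
  choose M hM using h1
  obtain ⟨A, hA⟩ := (Set.finite_range M).bddAbove
  exact ⟨A, fun j t ht => ⟨(hM j t (Set.Ioc_subset_Icc_self ht)).1.trans (hA ⟨j, rfl⟩),
    (hM j t (Set.Ioc_subset_Icc_self ht)).2.trans (hA ⟨j, rfl⟩)⟩⟩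

lemma Dominated.abs_le (hu : Dominated w h T u) (hS : Supersolution p u₀ w h m T) (j : Fin k)
    {t : ℝ} (ht : t ∈ Set.Ioc 0 T) (x : EuclideanSpace ℝ (Fin n)) :
    |u j t x| ≤ h j t * m t :=
  (hu.bound j t ht x).trans
    (mul_le_mul_of_nonneg_left (hS.heat_le t ht x) (hS.h_nonneg j t))

lemma integral_mul_exp_le {L K t : ℝ} (hK : 0 ≤ K) :
    ∫ τ in (0 : ℝ)..t, L * (K * Real.exp (2 * L * τ)) ≤ K / 2 * Real.exp (2 * L * t) := by
  have : ∀ τ ∈ Set.uIcc 0 t, HasDerivAt (fun τ => K / 2 * Real.exp (2 * L * τ))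
      (L * (K * Real.exp (2 * L * τ))) τ := by
    intro τ _
    have := (((hasDerivAt_id' τ).const_mul (2 * L)).exp).const_mul (K / 2)
    exact this.congr_deriv (by ring)
  rw [intervalIntegral.integral_eq_sub_of_hasDerivAt this
    (Continuous.intervalIntegrable (by fun_prop) _ _)]
  simp
  linarith

/-- `L` dominates every Lipschitz constant of the nonlinearities on the range allowed by the
supersolution. Since `∫₀ᵗ L e^{2Lτ} dτ ≤ e^{2Lt}/2`, the weight `e^{2Lt}` yields the factor `1/2` on
the whole interval, without shortening it. -/
lemma exists_contraction (hS : Supersolution p u₀ w h m T) :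
    ∃ L, 0 < L ∧ ∀ u v, Dominated w h T u → Dominated w h T v → ∀ K, 0 ≤ K →
      (∀ j, ∀ t ∈ Set.Ioc 0 T, ∀ x,
        |u j t x - v j t x| ≤ K * Real.exp (2 * L * t) * heat t w x) →
      ∀ j, ∀ t ∈ Set.Ioc 0 T, ∀ x,
        |HeatSystem.picard p u₀ u j t x - HeatSystem.picard p u₀ v j t x| ≤
          K / 2 * Real.exp (2 * L * t) * heat t w x := by
  obtain ⟨M, hM⟩ := hS.exists_bound
  set M' := max M 0 with hM'
  have hM0 : 0 ≤ M' := le_max_right _ _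
  set L := 1 + ∑ j, p j * M' ^ (p j - 1)
  have hterm : ∀ j, 0 ≤ p j * M' ^ (p j - 1) := fun j =>
    mul_nonneg (by linarith [hS.one_le j]) (Real.rpow_nonneg hM0 _)
  have hLj : ∀ j, p j * M' ^ (p j - 1) ≤ L := fun j => by
    have := Finset.single_le_sum (fun i _ => hterm i) (Finset.mem_univ j)
    linarith
  have hLpos : 0 < L := by
    have := Finset.sum_nonneg fun j (_ : j ∈ Finset.univ) => hterm j
    linarith
  refine ⟨L, hLpos, fun u v hu hv K hK huv j t ht x => ?_⟩
  have hlip : ∀ τ ∈ Set.Ioo 0 t, ∀ y,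
      |(|u (j + 1) τ y| ^ p j - |v (j + 1) τ y| ^ p j)| ≤
        L * (K * Real.exp (2 * L * τ)) * heat τ w y := by
    intro τ hτ y
    have hτ' : τ ∈ Set.Ioc 0 T := ⟨hτ.1, hτ.2.le.trans ht.2⟩
    have hb := (hM (j + 1) τ hτ').2.trans (le_max_left M 0)
    calc _ ≤ p j * M' ^ (p j - 1) * |u (j + 1) τ y - v (j + 1) τ y| :=
          abs_rpow_sub_rpow_le (hS.one_le j) ((hu.abs_le hS _ hτ' y).trans hb)
            ((hv.abs_le hS _ hτ' y).trans hb)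
      _ ≤ L * (K * Real.exp (2 * L * τ) * heat τ w y) :=
          mul_le_mul (hLj j) (huv _ τ hτ' y) (abs_nonneg _) hLpos.le
      _ = _ := by ring
  have hsub := duhamelIntegral_sub ht.1.le
    (fun τ hτ => hu.integrable_rpow hS j ⟨hτ.1, hτ.2.le.trans ht.2⟩)
    (fun τ hτ => hv.integrable_rpow hS j ⟨hτ.1, hτ.2.le.trans ht.2⟩) x
    (hu.intervalIntegrable hS j ht x) (hv.intervalIntegrable hS j ht x)
  unfold HeatSystem.picard
  rw [add_sub_add_left_eq_sub, hsub]
  refine (abs_duhamelIntegral_le hS.integrable ht.1.le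
    (Continuous.intervalIntegrable (by fun_prop) _ _) hlip x).trans ?_
  exact mul_le_mul_of_nonneg_right (integral_mul_exp_le hK) (hS.heat_nonneg ht.1 x)

/-- Under a supersolution the integral equation has a solution. -/
theorem exists_fixedPoint (hS : Supersolution p u₀ w h m T) :
    ∃ u, Dominated w h T u ∧ ∀ j, ∀ t ∈ Set.Ioc 0 T, ∀ x, u j t x = picard p u₀ u j t x := by
  obtain ⟨L, hL, hcontr⟩ := exists_contraction hS
  obtain ⟨M, hM⟩ := hS.exists_bound
  let U : ℕ → Fin k → ℝ → EuclideanSpace ℝ (Fin n) → ℝ := fun i =>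
    (picard p u₀)^[i] (fun _ _ _ => 0)
  have hUs : ∀ i, U (i + 1) = picard p u₀ (U i) := fun i =>
    Function.iterate_succ_apply' _ _ _
  have hU : ∀ i, Dominated w h T (U i) := by
    intro i
    induction i with
    | zero =>
      refine ⟨fun j => measurable_const, fun j t ht x => ?_⟩
      simp only [U, Function.iterate_zero, id, abs_zero]
      exact mul_nonneg (hS.h_nonneg j t) (hS.heat_nonneg ht.1 x)
    | succ i ih => rw [hUs]; exact ih.picard hS
  set K := max M 0 with hKdef
  have hK : 0 ≤ K := le_max_right _ _
  have hstep : ∀ i j, ∀ t ∈ Set.Ioc 0 T, ∀ x, |U i j t x - U (i + 1) j t x| ≤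
      K * (1 / 2) ^ i * Real.exp (2 * L * t) * heat t w x := by
    intro i
    induction i with
    | zero =>
      intro j t ht x
      have hW := hS.heat_nonneg ht.1 x
      rw [show U 0 j t x = 0 from rfl, zero_sub, abs_neg, pow_zero, mul_one]
      refine ((hU 1).bound j t ht x).trans (mul_le_mul_of_nonneg_right ?_ hW)
      have h1 : 1 ≤ Real.exp (2 * L * t) := Real.one_le_exp (by have := ht.1; positivity)
      exact ((hM j t ht).1.trans (le_max_left _ _)).trans (le_mul_of_one_le_right hK h1)
    | succ i ih =>
      intro j t ht x
      have := hcontr (U i) (U (i + 1)) (hU i) (hU (i + 1)) (K * (1 / 2) ^ i) (by positivity) ih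
        j t ht x
      rw [← hUs, ← hUs] at this
      refine this.trans_eq ?_
      rw [pow_succ]
      ring
  have hgeo : ∀ j, ∀ t ∈ Set.Ioc 0 T, ∀ x i, dist (U i j t x) (U (i + 1) j t x) ≤
      K * Real.exp (2 * L * t) * heat t w x * (1 / 2) ^ i := by
    intro j t ht x i
    rw [Real.dist_eq]
    exact (hstep i j t ht x).trans_eq (by ring)
  -- Convergence is known only on `(0,T]`. Cutting off outside makes the limit exist everywhere, so
  -- that it is jointly measurable as a pointwise limit.
  have hex : ∀ j t x, ∃ a, Tendsto (fun i => (Set.Ioc 0 T).indicator (fun t => U i j t x) t) atTop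
      (𝓝 a) := by
    intro j t x
    by_cases ht : t ∈ Set.Ioc 0 T
    · simp only [Set.indicator_of_mem ht]
      exact cauchySeq_tendsto_of_complete
        (cauchySeq_of_le_geometric _ _ (by norm_num) (hgeo j t ht x))
    · simp only [Set.indicator_of_notMem ht]
      exact ⟨0, tendsto_const_nhds⟩
  choose u hu using hex
  have hlim : ∀ j, ∀ t ∈ Set.Ioc 0 T, ∀ x, Tendsto (fun i => U i j t x) atTop (𝓝 (u j t x)) := by
    intro j t ht x
    have := hu j t x
    simpa only [Set.indicator_of_mem ht] using this
  have hclose : ∀ i j, ∀ t ∈ Set.Ioc 0 T, ∀ x, |U i j t x - u j t x| ≤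
      2 * K * (1 / 2) ^ i * Real.exp (2 * L * t) * heat t w x := by
    intro i j t ht x
    have := dist_le_of_le_geometric_of_tendsto _ _ (by norm_num) (hgeo j t ht x)
      (hlim j t ht x) i
    rw [Real.dist_eq] at this
    exact this.trans_eq (by ring)
  have hdom : Dominated w h T u := by
    refine ⟨fun j => ?_, fun j t ht x => ?_⟩
    · refine measurable_of_tendsto_metrizable (f := fun i (q : ℝ × EuclideanSpace ℝ (Fin n)) =>
        (Set.Ioc 0 T).indicator (fun t => U i j t q.2) q.1) (fun i => ?_)
        (tendsto_pi_nhds.2 fun q => hu j q.1 q.2)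
      exact ((hU i).measurable j).indicator (measurable_fst measurableSet_Ioc)
    · exact le_of_tendsto (hlim j t ht x).abs (.of_forall fun i => (hU i).bound j t ht x)
  refine ⟨u, hdom, fun j t ht x => ?_⟩
  -- `U (i+1) = picard (U i)` converges to `u` and, by contraction, also to `picard u`.
  refine tendsto_nhds_unique ((tendsto_add_atTop_iff_nat 1).2 (hlim j t ht x)) ?_
  rw [tendsto_iff_dist_tendsto_zero]
  refine squeeze_zero (fun _ => dist_nonneg)
    (g := fun i : ℕ => (1 / 2 : ℝ) ^ i * (K * Real.exp (2 * L * t) * heat t w x)) (fun i => ?_) ?_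
  · rw [hUs, Real.dist_eq]
    refine (hcontr (U i) u (hU i) hdom (2 * K * (1 / 2) ^ i) (by positivity) (hclose i)
      j t ht x).trans_eq (by ring)
  · have := (tendsto_pow_atTop_nhds_zero_of_lt_one (r := (1 / 2 : ℝ)) (by norm_num)
      (by norm_num)).mul_const (K * Real.exp (2 * L * t) * heat t w x)
    rwa [zero_mul] at this

end Picard

/-! ### Time regularity of the Duhamel term -/

section TimeRegularity

variable {n : ℕ} {w : EuclideanSpace ℝ (Fin n) → ℝ}
  {F : ℝ → EuclideanSpace ℝ (Fin n) → ℝ}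

lemma integral_div_sub_le {a b : ℝ} (ha : 0 < a) (hab : a < b) :
    ∫ τ in (0 : ℝ)..a, (b - a) / (b - τ) ≤ 2 * √b * √(b - a) := by
  have hd : 0 < b - a := sub_pos.2 hab
  have hpos : ∀ τ ∈ Set.Icc 0 a, 0 < b - τ := fun τ hτ => by linarith [hτ.2]
  have h1 : ContinuousOn (fun τ => (b - a) / (b - τ)) (Set.uIcc 0 a) := by
    rw [Set.uIcc_of_le ha.le]
    exact continuousOn_const.div (by fun_prop) fun τ hτ => (hpos τ hτ).ne'
  have h2 : ContinuousOn (fun τ => √(b - a) / √(b - τ)) (Set.uIcc 0 a) := by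
    rw [Set.uIcc_of_le ha.le]
    exact continuousOn_const.div (by fun_prop) fun τ hτ => (Real.sqrt_pos.2 (hpos τ hτ)).ne'
  have hder : ∀ τ ∈ Set.uIcc 0 a, HasDerivAt (fun τ => -(2 * √(b - a) * √(b - τ)))
      (√(b - a) / √(b - τ)) τ := by
    intro τ hτ
    rw [Set.uIcc_of_le ha.le] at hτ
    have h := ((((hasDerivAt_id' τ).const_sub b).sqrt (hpos τ hτ).ne').const_mul
      (2 * √(b - a))).neg
    refine h.congr_deriv ?_
    have := (Real.sqrt_pos.2 (hpos τ hτ)).ne'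
    field_simp
  calc ∫ τ in (0 : ℝ)..a, (b - a) / (b - τ) ≤ ∫ τ in (0 : ℝ)..a, √(b - a) / √(b - τ) := by
        refine intervalIntegral.integral_mono_on ha.le h1.intervalIntegrable
          h2.intervalIntegrable fun τ hτ => ?_
        have h3 := hpos τ hτ
        rw [← Real.sqrt_div hd.le]
        -- For a ratio `r ∈ [0,1]` one has `r ≤ √r`. This loses some decay but gives an elementary
        -- integral.
        apply Real.le_sqrt_of_sq_le
        have h4 : (b - a) / (b - τ) ≤ 1 := (div_le_one h3).2 (by linarith [hτ.2])
        have h5 : 0 ≤ (b - a) / (b - τ) := by positivity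
        nlinarith
    _ = -(2 * √(b - a) * √(b - a)) - -(2 * √(b - a) * √(b - 0)) :=
        intervalIntegral.integral_eq_sub_of_hasDerivAt hder h2.intervalIntegrable
    _ ≤ 2 * √b * √(b - a) := by
        rw [sub_zero]
        have : 0 ≤ 2 * √(b - a) * √(b - a) := by positivity
        linarith

/-- Split at `a`. The part over `(a,b)` is short; over `(0,a)` the flows at times `b-τ` and `a-τ`
are compared, with relative increment `(b-a)/(b-τ)`, which is integrated by `integral_div_sub_le`.
-/
lemma abs_duhamelIntegral_sub_le (hF : Measurable (Function.uncurry F)) (hw : Integrable w)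
    {A a b : ℝ} (ha : 0 < a) (hab : a < b)
    (h : ∀ τ ∈ Set.Ioo 0 b, ∀ y, |F τ y| ≤ A * heat τ w y)
    (hA : 0 ≤ A) (hw0 : ∀ x, 0 ≤ w x) (x : EuclideanSpace ℝ (Fin n)) :
    |duhamelIntegral F b x - duhamelIntegral F a x| ≤ (b - a) * A * heat b w x +
      A * a * (heat b w x - heat a w x) +
      2 * n * A * heat a w x * (2 * √b * √(b - a)) := by
  have hb : 0 < b := ha.trans hab
  have hi : IntervalIntegrable (fun τ => heat (b - τ) (F τ) x) volume 0 b :=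
    intervalIntegrable_heat hF hw hb.le (intervalIntegrable_const (c := A)) h x
  have hia : IntervalIntegrable (fun τ => heat (a - τ) (F τ) x) volume 0 a :=
    intervalIntegrable_heat hF hw ha.le (intervalIntegrable_const (c := A))
      (fun τ hτ => h τ ⟨hτ.1, hτ.2.trans hab⟩) x
  have hi1 : IntervalIntegrable (fun τ => heat (b - τ) (F τ) x) volume 0 a :=
    hi.mono_set (by
      rw [Set.uIcc_of_le ha.le, Set.uIcc_of_le hb.le]
      exact Set.Icc_subset_Icc_right hab.le)
  have hi2 : IntervalIntegrable (fun τ => heat (b - τ) (F τ) x) volume a b :=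
    hi.mono_set (by
      rw [Set.uIcc_of_le hab.le, Set.uIcc_of_le hb.le]
      exact Set.Icc_subset_Icc_left ha.le)
  have hsplit : duhamelIntegral F b x - duhamelIntegral F a x =
      (∫ τ in a..b, heat (b - τ) (F τ) x) +
        ∫ τ in (0 : ℝ)..a, (heat (b - τ) (F τ) x - heat (a - τ) (F τ) x) := by
    unfold duhamelIntegral
    rw [intervalIntegral.integral_sub hi1 hia,
      ← intervalIntegral.integral_add_adjacent_intervals hi1 hi2]
    ring
  have h1 : |∫ τ in a..b, heat (b - τ) (F τ) x| ≤ (b - a) * A * heat b w x := by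
    have := intervalIntegral.norm_integral_le_of_norm_le hab.le
      (f := fun τ => heat (b - τ) (F τ) x) (g := fun _ => A * heat b w x) (μ := volume) (by
        filter_upwards [Measure.ae_ne volume b] with τ hne hτ
        exact abs_heat_le_of_mem_Ioo hw h x τ ⟨ha.trans hτ.1, lt_of_le_of_ne hτ.2 hne⟩)
      intervalIntegrable_const
    rw [intervalIntegral.integral_const, smul_eq_mul, ← mul_assoc] at this
    exact this
  have hcont : ContinuousOn (fun τ => (b - a) / (b - τ)) (Set.uIcc 0 a) := by
    rw [Set.uIcc_of_le ha.le]
    exact continuousOn_const.div (by fun_prop) fun τ hτ => by linarith [hτ.2]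
  have h2 : |∫ τ in (0 : ℝ)..a, (heat (b - τ) (F τ) x - heat (a - τ) (F τ) x)| ≤
      ∫ τ in (0 : ℝ)..a, (A * (heat b w x - heat a w x) +
        2 * n * A * heat a w x * ((b - a) / (b - τ))) := by
    rw [← Real.norm_eq_abs]
    refine intervalIntegral.norm_integral_le_of_norm_le ha.le ?_
      (intervalIntegrable_const.add (hcont.intervalIntegrable.const_mul _))
    filter_upwards [Measure.ae_ne volume a] with τ hne hτ
    have hτa : τ < a := lt_of_le_of_ne hτ.2 hne
    have hWi := integrable_heat hτ.1 hw
    have hFi : Integrable (F τ) := (hWi.const_mul A).mono'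
      (hF.comp measurable_prodMk_left).aestronglyMeasurable
      (.of_forall (h τ ⟨hτ.1, hτa.trans hab⟩))
    have := abs_heat_sub_heat_le (sub_pos.2 hτa) (by linarith : a - τ ≤ b - τ) hFi
      (hWi.const_mul A) (.of_forall (h τ ⟨hτ.1, hτa.trans hab⟩)) x
    rw [heat_const_mul, heat_const_mul, heat_heat (sub_pos.2 hτa) hτ.1 hw,
      heat_heat (sub_pos.2 (hτa.trans hab)) hτ.1 hw] at this
    simp only [sub_add_cancel, sub_sub_sub_cancel_right] at this
    refine this.trans_eq ?_
    ring
  rw [intervalIntegral.integral_add intervalIntegrable_const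
    (hcont.intervalIntegrable.const_mul _), intervalIntegral.integral_const,
    intervalIntegral.integral_const_mul, smul_eq_mul, sub_zero] at h2
  have h3 := mul_le_mul_of_nonneg_left (integral_div_sub_le ha hab)
    (mul_nonneg (by positivity : 0 ≤ 2 * n * A) (heat_nonneg ha hw0 x))
  rw [hsplit]
  refine (abs_add_le _ _).trans ?_
  linarith

lemma eLpNorm_one_le_integral {f g : EuclideanSpace ℝ (Fin n) → ℝ} (hg : Integrable g)
    (h : ∀ x, |f x| ≤ g x) : eLpNorm f 1 volume ≤ ENNReal.ofReal (∫ x, g x) := by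
  rw [ofReal_integral_eq_lintegral_ofReal hg
    (.of_forall fun x => (abs_nonneg _).trans (h x)), eLpNorm_one_eq_lintegral_enorm]
  refine lintegral_mono fun x => ?_
  rw [← ofReal_norm]
  exact ENNReal.ofReal_le_ofReal (h x)

lemma eLpNorm_top_le {f : EuclideanSpace ℝ (Fin n) → ℝ} {M : ℝ}
    (h : ∀ᵐ x, |f x| ≤ M) : eLpNorm f ∞ volume ≤ ENNReal.ofReal M := by
  rw [eLpNorm_exponent_top]
  exact eLpNormEssSup_le_of_ae_bound h

/-- The modulus of continuity in time of the solutions. -/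
def timeModulus (a b : ℝ) : ℝ := (b - a) / b + √(b - a) + (b - a)

lemma tendsto_eLpNorm_of_timeModulus {f : ℝ → EuclideanSpace ℝ (Fin n) → ℝ} {C T t : ℝ}
    {q : ℝ≥0∞} {l : Filter ℝ}
    (h : ∀ a b, 0 < a → a < b → b ≤ T →
      eLpNorm (f b - f a) q volume ≤ ENNReal.ofReal (C * timeModulus a b))
    (ht : t ∈ Set.Ioc 0 T) (hl : l ≤ 𝓝 t) (hs : ∀ᶠ s in l, s ∈ Set.Ioc 0 T) :
    Tendsto (fun s => eLpNorm (f s - f t) q volume) l (𝓝 0) := by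
  -- With `|s - t|` and `max s t` one expression covers both orders of `s` and `t`.
  have hlim : Tendsto (fun s => ENNReal.ofReal
      (C * (|s - t| / max s t + √|s - t| + |s - t|))) l (𝓝 0) := by
    have hc : ContinuousAt (fun s => C * (|s - t| / max s t + √|s - t| + |s - t|)) t := by
      have : max t t ≠ 0 := by rw [max_self]; exact ht.1.ne'
      fun_prop (disch := assumption)
    have h0 := ENNReal.tendsto_ofReal (hc.tendsto.mono_left hl)
    simpa using h0
  refine tendsto_of_tendsto_of_tendsto_of_le_of_le' tendsto_const_nhds hlim
    (.of_forall fun _ => zero_le) ?_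
  filter_upwards [hs] with s hs
  rcases lt_trichotomy s t with hst | hst | hst
  · rw [eLpNorm_sub_comm, abs_of_neg (sub_neg.2 hst), neg_sub, max_eq_right hst.le]
    exact h s t hs.1 hst ht.2
  · simp [hst]
  · rw [abs_of_pos (sub_pos.2 hst), max_eq_left hst.le]
    exact h t s ht.1 hst hs.2

end TimeRegularity

/-! ### Existence of solutions below a supersolution -/

section Existence

variable {n k : ℕ} [NeZero k] {p : Fin k → ℝ} {u₀ : Fin k → EuclideanSpace ℝ (Fin n) → ℝ}
  {w : EuclideanSpace ℝ (Fin n) → ℝ} {h : Fin k → ℝ → ℝ} {m : ℝ → ℝ} {T : ℝ}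
  {u : Fin k → ℝ → EuclideanSpace ℝ (Fin n) → ℝ}

lemma Supersolution.exists_amp_bound (hS : Supersolution p u₀ w h m T) (j : Fin k) :
    ∃ A, 0 ≤ A ∧ ∀ t ∈ Set.Ioc 0 T, h (j + 1) t ^ p j * m t ^ (p j - 1) ≤ A := by
  obtain ⟨A, hA⟩ := isCompact_Icc.bddAbove_image
    ((hS.continuous_amp j).continuousOn (s := Set.Icc 0 T))
  exact ⟨max A 0, le_max_right _ _, fun t ht =>
    (hA (Set.mem_image_of_mem _ (Set.Ioc_subset_Icc_self ht))).trans (le_max_left _ _)⟩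

lemma Dominated.exists_rpow_le (hu : Dominated w h T u) (hS : Supersolution p u₀ w h m T)
    (j : Fin k) : ∃ A, 0 ≤ A ∧ ∀ τ ∈ Set.Ioc 0 T, ∀ y,
      |(|u (j + 1) τ y| ^ p j)| ≤ A * heat τ w y := by
  obtain ⟨A, hA, hAle⟩ := hS.exists_amp_bound j
  exact ⟨A, hA, fun τ hτ y => (hu.rpow_le hS j hτ y).trans
    (mul_le_mul_of_nonneg_right (hAle τ hτ) (hS.heat_nonneg hτ.1 y))⟩

lemma Dominated.exists_time_modulus (hu : Dominated w h T u) (hS : Supersolution p u₀ w h m T)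
    (hfix : ∀ j, ∀ t ∈ Set.Ioc 0 T, ∀ x, u j t x = HeatSystem.picard p u₀ u j t x) (j : Fin k) :
    ∃ C, 0 ≤ C ∧ ∀ a b, 0 < a → a < b → b ≤ T → ∀ x,
      |u j b x - u j a x| ≤ C * (|heat b w x - heat a w x| +
        timeModulus a b * (heat a w x + heat b w x)) := by
  obtain ⟨A, hA, hF⟩ := hu.exists_rpow_le hS j
  -- The terms `1` and `2n` come from the linear flow; `A`, `A|T|` and `4nA√T` come from the three
  -- terms of `abs_duhamelIntegral_sub_le`.
  refine ⟨1 + 2 * n + A + A * |T| + 4 * n * A * √T, by positivity, fun a b ha hab hbT x => ?_⟩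
  have hb : 0 < b := ha.trans hab
  have hd : 0 < b - a := sub_pos.2 hab
  have h1 := abs_heat_sub_heat_le ha hab.le (hS.integrable_init j) hS.integrable
    (.of_forall (hS.abs_init_le j)) x
  have h2 := abs_duhamelIntegral_sub_le (hu.measurable_rpow p (j + 1) j) hS.integrable ha hab
    (fun τ hτ => hF τ ⟨hτ.1, hτ.2.le.trans hbT⟩) hA hS.w_nonneg x
  rw [hfix j b ⟨hb, hbT⟩, hfix j a ⟨ha, hab.le.trans hbT⟩]
  unfold HeatSystem.picard
  rw [add_sub_add_comm]
  refine (abs_add_le _ _).trans ?_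
  have hWa := hS.heat_nonneg ha x
  have hWb := hS.heat_nonneg hb x
  set Wa := heat a w x
  set Wb := heat b w x
  have hΔ : Wb - Wa ≤ |Wb - Wa| := le_abs_self _
  have hΔ0 : 0 ≤ |Wb - Wa| := abs_nonneg _
  have hr1 : 0 ≤ (b - a) / b := by positivity
  have hr2 : 0 ≤ √(b - a) := Real.sqrt_nonneg _
  set ρ := timeModulus a b with hρ
  have e1 : (b - a) / b * Wa ≤ ρ * (Wa + Wb) :=
    mul_le_mul (by rw [hρ, timeModulus]; linarith) (by linarith) hWa
      (by rw [hρ, timeModulus]; linarith)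
  have e2 : (b - a) * Wb ≤ ρ * (Wa + Wb) :=
    mul_le_mul (by rw [hρ, timeModulus]; linarith) (by linarith) hWb
      (by rw [hρ, timeModulus]; linarith)
  have e3 : √(b - a) * Wa ≤ ρ * (Wa + Wb) :=
    mul_le_mul (by rw [hρ, timeModulus]; linarith) (by linarith) hWa
      (by rw [hρ, timeModulus]; linarith)
  have hX0 : 0 ≤ ρ * (Wa + Wb) := le_trans (by positivity) e1
  set X := ρ * (Wa + Wb)
  have f1 : 2 * n * ((b - a) / b) * Wa ≤ 2 * n * X := by
    rw [mul_assoc (2 * (n : ℝ))]; exact mul_le_mul_of_nonneg_left e1 (by positivity)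
  have f2 : (b - a) * A * Wb ≤ A * X := by
    rw [mul_comm (b - a), mul_assoc]; exact mul_le_mul_of_nonneg_left e2 hA
  have f3 : A * a * (Wb - Wa) ≤ A * |T| * |Wb - Wa| := by
    refine (mul_le_mul_of_nonneg_left hΔ (by positivity)).trans
      (mul_le_mul_of_nonneg_right ?_ hΔ0)
    exact mul_le_mul_of_nonneg_left ((hab.le.trans hbT).trans (le_abs_self T)) hA
  have f4 : 2 * n * A * Wa * (2 * √b * √(b - a)) ≤ 4 * n * A * √T * X := by
    have : 2 * n * A * Wa * (2 * √b * √(b - a)) = 4 * n * A * √b * (√(b - a) * Wa) := by ring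
    rw [this]
    exact mul_le_mul (mul_le_mul_of_nonneg_left (Real.sqrt_le_sqrt hbT) (by positivity)) e3
      (by positivity) (by positivity)
  have g1 : 0 ≤ (2 * n + A + 4 * n * A * √T) * |Wb - Wa| := by positivity
  have g2 : 0 ≤ (1 + A * |T|) * X := by positivity
  linarith

lemma timeModulus_nonneg {a b : ℝ} (ha : 0 < a) (hab : a < b) : 0 ≤ timeModulus a b := by
  have hb : 0 < b := ha.trans hab
  have hd : 0 < b - a := sub_pos.2 hab
  unfold timeModulus
  positivity

lemma div_le_timeModulus {a b : ℝ} (hab : a < b) : (b - a) / b ≤ timeModulus a b := by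
  have hd : 0 < b - a := sub_pos.2 hab
  have := Real.sqrt_nonneg (b - a)
  unfold timeModulus
  linarith

lemma Dominated.exists_eLpNorm_one_le (hu : Dominated w h T u)
    (hS : Supersolution p u₀ w h m T)
    (hfix : ∀ j, ∀ t ∈ Set.Ioc 0 T, ∀ x, u j t x = HeatSystem.picard p u₀ u j t x) (j : Fin k) :
    ∃ C, ∀ a b, 0 < a → a < b → b ≤ T →
      eLpNorm (u j b - u j a) 1 volume ≤ ENNReal.ofReal (C * timeModulus a b) := by
  obtain ⟨C, hC, hle⟩ := hu.exists_time_modulus hS hfix j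
  refine ⟨C * ((2 * n + 2) * ∫ x, w x), fun a b ha hab hbT => ?_⟩
  have hb : 0 < b := ha.trans hab
  have hia := integrable_heat ha hS.integrable
  have hib := integrable_heat hb hS.integrable
  have hρ := timeModulus_nonneg ha hab
  have hI : 0 ≤ ∫ x, w x := integral_nonneg hS.w_nonneg
  -- The signed difference has integral zero by conservation of mass, so only the `(b-a)/b` term
  -- survives.
  have hΔ : ∫ x, |heat b w x - heat a w x| ≤ 2 * n * ((b - a) / b) * ∫ x, w x := by
    have hsub : Integrable fun x => heat b w x - heat a w x := hib.sub hia
    refine (integral_mono hsub.abs (hsub.add (hia.const_mul (2 * n * ((b - a) / b)))) fun x =>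
      abs_heat_sub_heat_le ha hab.le hS.integrable hS.integrable
        (.of_forall fun y => (abs_of_nonneg (hS.w_nonneg y)).le) x).trans_eq ?_
    simp only [Pi.add_apply]
    rw [integral_add hsub (hia.const_mul _), integral_sub hib hia, integral_const_mul,
      integral_heat ha hS.integrable, integral_heat hb hS.integrable]
    ring
  have hsum : Integrable fun x => timeModulus a b * (heat a w x + heat b w x) :=
    (hia.add hib).const_mul _
  have habs : Integrable fun x => |heat b w x - heat a w x| := (hib.sub hia).abs
  refine (eLpNorm_one_le_integral ((habs.add hsum).const_mul C) (hle a b ha hab hbT)).trans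
    (ENNReal.ofReal_le_ofReal ?_)
  simp only [Pi.add_apply]
  rw [integral_const_mul, integral_add habs hsum, integral_const_mul, integral_add hia hib,
    integral_heat ha hS.integrable, integral_heat hb hS.integrable, mul_assoc]
  refine mul_le_mul_of_nonneg_left ?_ hC
  have h1 : 2 * n * ((b - a) / b) * ∫ x, w x ≤ 2 * n * timeModulus a b * ∫ x, w x := by
    have := div_le_timeModulus hab
    gcongr
  linarith

lemma Dominated.exists_eLpNorm_top_le (hu : Dominated w h T u)
    (hS : Supersolution p u₀ w h m T)
    (hfix : ∀ j, ∀ t ∈ Set.Ioc 0 T, ∀ x, u j t x = HeatSystem.picard p u₀ u j t x)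
    {B : ℝ} (hB : ∀ᵐ x, w x ≤ B) (hB0 : 0 ≤ B) (j : Fin k) :
    ∃ C, ∀ a b, 0 < a → a < b → b ≤ T →
      eLpNorm (u j b - u j a) ∞ volume ≤ ENNReal.ofReal (C * timeModulus a b) := by
  obtain ⟨C, hC, hle⟩ := hu.exists_time_modulus hS hfix j
  have hB' : ∀ᵐ x, |w x| ≤ B := by
    filter_upwards [hB] with x hx
    rwa [abs_of_nonneg (hS.w_nonneg x)]
  refine ⟨C * ((2 * n + 2) * B), fun a b ha hab hbT => eLpNorm_top_le (.of_forall fun x => ?_)⟩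
  have hb : 0 < b := ha.trans hab
  refine (hle a b ha hab hbT x).trans ?_
  rw [mul_assoc]
  refine mul_le_mul_of_nonneg_left ?_ hC
  have hρ := timeModulus_nonneg ha hab
  have h1 := abs_heat_sub_heat_le_const ha hab.le hS.integrable hB' x
  have h2 : 2 * n * ((b - a) / b) * B ≤ 2 * n * timeModulus a b * B := by
    have := div_le_timeModulus hab
    gcongr
  have h3 := (le_abs_self _).trans (abs_heat_le_const ha hB' x)
  have h4 := (le_abs_self _).trans (abs_heat_le_const hb hB' x)
  have h5 := mul_le_mul_of_nonneg_left (add_le_add h3 h4) hρ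
  linarith

lemma Supersolution.exists_isSolution (hS : Supersolution p u₀ w h m T) {B : ℝ}
    (hB : ∀ᵐ x, w x ≤ B) (hB0 : 0 ≤ B) : ∃ u, IsSolution p u₀ T u := by
  obtain ⟨u, hu, hfix⟩ := exists_fixedPoint hS
  -- The fixed point equation says nothing at `t = 0`, so the initial value is inserted by hand.
  let v : Fin k → ℝ → EuclideanSpace ℝ (Fin n) → ℝ := fun j t =>
    if t = 0 then u₀ j else u j t
  have hv0 : ∀ j, v j 0 = u₀ j := fun j => if_pos rfl
  have hv : ∀ j t, t ≠ 0 → v j t = u j t := fun j t ht => if_neg ht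
  obtain ⟨M, hM⟩ := hS.exists_bound
  have hmeas : ∀ j t, AEStronglyMeasurable (u j t) volume := fun j t =>
    ((hu.measurable j).comp measurable_prodMk_left).aestronglyMeasurable
  have hB' : ∀ᵐ x, |w x| ≤ B := by
    filter_upwards [hB] with x hx
    rwa [abs_of_nonneg (hS.w_nonneg x)]
  have h0 : ∀ j, ∀ᵐ x, |u₀ j x| ≤ B := fun j => by
    filter_upwards [hB] with x hx using (hS.abs_init_le j x).trans hx
  have hIco : ∀ t ∈ Set.Ico 0 T, t ≠ 0 → t ∈ Set.Ioc 0 T := fun t ht h =>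
    ⟨lt_of_le_of_ne ht.1 (Ne.symm h), ht.2.le⟩
  have hub : ∀ j, ∀ t ∈ Set.Ioc 0 T, ∀ x, |u j t x| ≤ M * B := by
    intro j t ht x
    refine (hu.bound j t ht x).trans ?_
    exact mul_le_mul (hM j t ht).1 ((le_abs_self _).trans (abs_heat_le_const ht.1 hB' x))
      (hS.heat_nonneg ht.1 x) ((hS.h_nonneg j t).trans (hM j t ht).1)
  refine ⟨v, ⟨?_, ?_, ?_, ?_, ?_, ?_, ?_⟩⟩
  · intro j t ht
    rw [memLp_one_iff_integrable]
    by_cases ht0 : t = 0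
    · rw [ht0, hv0]
      exact hS.integrable_init j
    · rw [hv j t ht0]
      have ht' := hIco t ht ht0
      exact ((integrable_heat ht'.1 hS.integrable).const_mul (h j t)).mono'
        (hmeas j t) (.of_forall (hu.bound j t ht'))
  · intro j t ht
    by_cases ht0 : t = 0
    · rw [ht0, hv0]
      exact memLp_top_of_bound (hS.measurable_init j).aestronglyMeasurable B (h0 j)
    · rw [hv j t ht0]
      exact memLp_top_of_bound (hmeas j t) (M * B) (.of_forall (hub j t (hIco t ht ht0)))
  · intro j t ht
    by_cases ht0 : t = 0
    · subst ht0
      have hT : 0 < T := ht.2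
      rw [← Set.Ioo_insert_left hT, nhdsWithin_insert, tendsto_sup]
      refine ⟨?_, ?_⟩
      · rw [tendsto_pure_left]
        intro s hs
        simpa using mem_of_mem_nhds hs
      obtain ⟨A, hA, hF⟩ := hu.exists_rpow_le hS j
      have hlim1 := (tendsto_eLpNorm_heat_sub (hS.measurable_init j)
        (hS.integrable_init j)).mono_left (nhdsWithin_mono 0
          (fun s (hs : s ∈ Set.Ioo 0 T) => hs.1))
      have hlim2 : Tendsto (fun s => ENNReal.ofReal (s * A * ∫ x, w x)) (𝓝[Set.Ioo 0 T] 0)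
          (𝓝 0) := by
        have : Continuous fun s => ENNReal.ofReal (s * A * ∫ x, w x) :=
          ENNReal.continuous_ofReal.comp (by fun_prop)
        have h1 := this.tendsto 0
        simp only [zero_mul, ENNReal.ofReal_zero] at h1
        exact h1.mono_left nhdsWithin_le_nhds
      have hlim := hlim1.add hlim2
      rw [add_zero] at hlim
      refine tendsto_of_tendsto_of_tendsto_of_le_of_le' tendsto_const_nhds hlim
        (.of_forall fun _ => zero_le) ?_
      filter_upwards [self_mem_nhdsWithin] with s hs
      have hsT : s ∈ Set.Ioc 0 T := ⟨hs.1, hs.2.le⟩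
      rw [hv0, hv j s hs.1.ne']
      -- Near time zero the first summand is handled by strong continuity of the semigroup in `L¹`;
      -- the Duhamel part has norm at most `s · A · ∫ w`.
      have hdec : u j s - u₀ j = (fun x => heat s (u₀ j) x - u₀ j x) +
          duhamelIntegral (fun τ y => |u (j + 1) τ y| ^ p j) s := by
        ext x
        simp only [Pi.sub_apply, Pi.add_apply]
        rw [hfix j s hsT x]
        unfold HeatSystem.picard
        ring
      have hDm : Measurable (duhamelIntegral (fun τ y => |u (j + 1) τ y| ^ p j) s) :=
        (measurable_duhamelIntegral (hu.measurable_rpow p (j + 1) j)).comp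
          measurable_prodMk_left
      rw [hdec]
      refine (eLpNorm_add_le ((integrable_heat hs.1 (hS.integrable_init j)).sub
        (hS.integrable_init j)).aestronglyMeasurable hDm.aestronglyMeasurable le_rfl).trans
        (add_le_add le_rfl ?_)
      have hD := abs_duhamelIntegral_le hS.integrable hs.1.le
        (intervalIntegrable_const (c := A) (μ := volume)) (fun τ hτ =>
          hF τ ⟨hτ.1, hτ.2.le.trans hsT.2⟩)
      refine (eLpNorm_one_le_integral ((integrable_heat hs.1 hS.integrable).const_mul _)
        hD).trans_eq ?_
      rw [integral_const_mul, integral_heat hs.1 hS.integrable, intervalIntegral.integral_const,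
        sub_zero, smul_eq_mul]
    · have ht' := hIco t ht ht0
      obtain ⟨C, hC⟩ := hu.exists_eLpNorm_one_le hS hfix j
      have hev : ∀ᶠ s in 𝓝[Set.Ico 0 T] t, s ∈ Set.Ioc 0 T := by
        filter_upwards [self_mem_nhdsWithin,
          mem_nhdsWithin_of_mem_nhds (Ioi_mem_nhds ht'.1)] with s hs hs'
        exact ⟨hs', hs.2.le⟩
      refine (tendsto_eLpNorm_of_timeModulus hC ht' nhdsWithin_le_nhds hev).congr' ?_
      filter_upwards [hev] with s hs
      rw [hv j s hs.1.ne', hv j t ht0]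
  · intro j t ht
    have ht' : t ∈ Set.Ioc 0 T := ⟨ht.1, ht.2.le⟩
    obtain ⟨C, hC⟩ := hu.exists_eLpNorm_top_le hS hfix hB hB0 j
    have hev : ∀ᶠ s in 𝓝[Set.Ioo 0 T] t, s ∈ Set.Ioc 0 T := by
      filter_upwards [self_mem_nhdsWithin] with s hs using ⟨hs.1, hs.2.le⟩
    refine (tendsto_eLpNorm_of_timeModulus hC ht' nhdsWithin_le_nhds hev).congr' ?_
    filter_upwards [hev] with s hs
    rw [hv j s hs.1.ne', hv j t ht.1.ne']
  · intro j S hS'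
    refine ⟨max B (M * B), fun t ht => eLpNorm_top_le ?_⟩
    by_cases ht0 : t = 0
    · rw [ht0, hv0]
      filter_upwards [h0 j] with x hx using hx.trans (le_max_left _ _)
    · rw [hv j t ht0]
      exact .of_forall fun x => (hub j t (hIco t ⟨ht.1, ht.2.trans_lt hS'.2⟩ ht0) x).trans
        (le_max_right _ _)
  · intro j
    rw [hv0]
  · intro j t ht
    refine .of_forall fun x => ?_
    rw [hv j t ht.1.ne', hfix j t ⟨ht.1, ht.2.le⟩ x]
    unfold HeatSystem.picard duhamelIntegral
    congr 1
    refine intervalIntegral.integral_congr_ae ?_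
    filter_upwards [Measure.ae_ne volume 0] with τ hne _
    rw [hv (j + 1) τ hne]

end Existence

/-! ### Uniqueness in the whole solution class -/

section Uniqueness

variable {n k : ℕ} [NeZero k] {p : Fin k → ℝ} {u₀ : Fin k → EuclideanSpace ℝ (Fin n) → ℝ}
  {T : ℝ} {u v : Fin k → ℝ → EuclideanSpace ℝ (Fin n) → ℝ}

lemma ae_abs_le_toReal_eLpNorm_top {f : EuclideanSpace ℝ (Fin n) → ℝ}
    (hf : eLpNorm f ∞ volume ≠ ∞) : ∀ᵐ x, |f x| ≤ (eLpNorm f ∞ volume).toReal := by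
  rw [eLpNorm_exponent_top] at hf ⊢
  filter_upwards [ae_le_eLpNormEssSup (f := f) (μ := volume)] with x hx
  have := ENNReal.toReal_mono hf hx
  rwa [toReal_enorm, Real.norm_eq_abs] at this

lemma ae_abs_le_of_eLpNorm_top_le {f : EuclideanSpace ℝ (Fin n) → ℝ} {M : ℝ}
    (hf : eLpNorm f ∞ volume ≤ ENNReal.ofReal M) : ∀ᵐ x, |f x| ≤ max M 0 := by
  filter_upwards [ae_abs_le_toReal_eLpNorm_top (ne_top_of_le_ne_top ENNReal.ofReal_ne_top hf)]
    with x hx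
  refine hx.trans ((ENNReal.toReal_mono ENNReal.ofReal_ne_top hf).trans_eq ?_)
  rw [ENNReal.toReal_ofReal']

lemma IsSolution.exists_bound (hu : IsSolution p u₀ T u) {t : ℝ} (ht : t ∈ Set.Ioo 0 T) :
    ∃ M, 0 ≤ M ∧ ∀ j, ∀ τ ∈ Set.Icc 0 t, ∀ᵐ x, |u j τ x| ≤ M := by
  choose M hM using fun j => hu.bounded_top j t ht
  obtain ⟨A, hA⟩ := (Set.finite_range M).bddAbove
  refine ⟨max A 0, le_max_right _ _, fun j τ hτ => ?_⟩
  filter_upwards [ae_abs_le_of_eLpNorm_top_le (hM j τ hτ)] with x hx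
  exact hx.trans (max_le_max_right 0 (hA ⟨j, rfl⟩))

lemma integrable_abs_rpow {f : EuclideanSpace ℝ (Fin n) → ℝ} (hf : MemLp f 1 volume) {M q : ℝ}
    (hq : 1 ≤ q) (hM : ∀ᵐ x, |f x| ≤ M) : Integrable fun x => |f x| ^ q := by
  have hi := memLp_one_iff_integrable.1 hf
  refine (hi.abs.const_mul (q * M ^ (q - 1))).mono'
    ((hf.1.aemeasurable.abs.pow_const q).aestronglyMeasurable) ?_
  filter_upwards [hM] with x hx
  have := abs_rpow_sub_rpow_le hq hx (b := 0) (by rw [abs_zero]; exact (abs_nonneg _).trans hx)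
  rwa [abs_zero, Real.zero_rpow (by linarith), sub_zero, sub_zero] at this

lemma continuousAt_heat_time {f : EuclideanSpace ℝ (Fin n) → ℝ} (hf : Integrable f) {M : ℝ}
    (hM : ∀ᵐ x, |f x| ≤ M) (x : EuclideanSpace ℝ (Fin n)) {t : ℝ} (ht : 0 < t) :
    ContinuousAt (fun s => heat s f x) t := by
  have hlim : Tendsto (fun s => 2 * n * (|s - t| / max s t) * M) (𝓝 t) (𝓝 0) := by
    have hc : ContinuousAt (fun s => 2 * n * (|s - t| / max s t) * M) t := by
      have : max t t ≠ 0 := by rw [max_self]; exact ht.ne'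
      fun_prop (disch := assumption)
    simpa using hc.tendsto
  rw [ContinuousAt, tendsto_iff_dist_tendsto_zero]
  refine squeeze_zero' (.of_forall fun _ => dist_nonneg) ?_ hlim
  filter_upwards [Ioi_mem_nhds ht] with s hs
  rw [Real.dist_eq]
  rcases le_total s t with hst | hst
  · rw [abs_sub_comm, abs_sub_comm s t, abs_of_nonneg (sub_nonneg.2 hst), max_eq_right hst]
    exact abs_heat_sub_heat_le_const hs hst hf hM x
  · rw [abs_of_nonneg (sub_nonneg.2 hst), max_eq_left hst]
    exact abs_heat_sub_heat_le_const ht hst hf hM x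

/-- A solution is not assumed jointly measurable in time and space. Measurability of the integrand
in `τ` comes instead from continuity on the open interval, a consequence of continuity in `L^∞`;
boundedness then suffices. -/
lemma IsSolution.intervalIntegrable (hu : IsSolution p u₀ T u) (hp : ∀ j, 1 ≤ p j) (j : Fin k)
    {t : ℝ} (ht : t ∈ Set.Ioo 0 T) (x : EuclideanSpace ℝ (Fin n)) :
    IntervalIntegrable (fun τ => heat (t - τ) (fun y => |u (j + 1) τ y| ^ p j) x) volume 0 t := by
  obtain ⟨M, hM0, hM⟩ := hu.exists_bound ht
  have hpow : ∀ τ ∈ Set.Icc 0 t, ∀ᵐ y, |(|u (j + 1) τ y| ^ p j)| ≤ M ^ p j := by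
    intro τ hτ
    filter_upwards [hM (j + 1) τ hτ] with y hy
    rw [abs_of_nonneg (by positivity)]
    exact Real.rpow_le_rpow (abs_nonneg _) hy (by linarith [hp j])
  have hint : ∀ τ ∈ Set.Icc 0 t, Integrable fun y => |u (j + 1) τ y| ^ p j := fun τ hτ =>
    integrable_abs_rpow (hu.memLp_one (j + 1) τ ⟨hτ.1, hτ.2.trans_lt ht.2⟩) (hp j)
      (hM (j + 1) τ hτ)
  have hcont : ContinuousOn (fun τ => heat (t - τ) (fun y => |u (j + 1) τ y| ^ p j) x)
      (Set.Ioo 0 t) := by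
    intro τ₀ hτ₀
    have hτ₀T : τ₀ ∈ Set.Ioo 0 T := ⟨hτ₀.1, hτ₀.2.trans ht.2⟩
    set N : ℝ → ℝ := fun τ => (eLpNorm (u (j + 1) τ - u (j + 1) τ₀) ∞ volume).toReal
    set R : ℝ → ℝ := fun τ => |heat (t - τ) (fun y => |u (j + 1) τ₀ y| ^ p j) x -
      heat (t - τ₀) (fun y => |u (j + 1) τ₀ y| ^ p j) x|
    have hN : Tendsto N (𝓝[Set.Ioo 0 t] τ₀) (𝓝 0) := by
      have := (ENNReal.tendsto_toReal ENNReal.zero_ne_top).comp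
        (hu.continuous_top (j + 1) τ₀ hτ₀T)
      exact this.mono_left (nhdsWithin_mono _ (Set.Ioo_subset_Ioo_right ht.2.le))
    have hR : Tendsto R (𝓝[Set.Ioo 0 t] τ₀) (𝓝 0) := by
      have h1 := continuousAt_heat_time (hint τ₀ ⟨hτ₀.1.le, hτ₀.2.le⟩)
        (hpow τ₀ ⟨hτ₀.1.le, hτ₀.2.le⟩) x (sub_pos.2 hτ₀.2)
      have h2 : Tendsto (fun τ => t - τ) (𝓝[Set.Ioo 0 t] τ₀) (𝓝 (t - τ₀)) :=
        ((by fun_prop : Continuous fun τ => t - τ).tendsto τ₀).mono_left nhdsWithin_le_nhds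
      have h3 := tendsto_iff_dist_tendsto_zero.1 (h1.tendsto.comp h2)
      simpa only [Real.dist_eq] using! h3
    have hlim := (hN.const_mul (p j * M ^ (p j - 1))).add hR
    rw [mul_zero, add_zero] at hlim
    rw [ContinuousWithinAt, tendsto_iff_dist_tendsto_zero]
    refine squeeze_zero' (.of_forall fun _ => dist_nonneg) ?_ hlim
    filter_upwards [self_mem_nhdsWithin] with τ hτ
    have hτI : τ ∈ Set.Icc 0 t := ⟨hτ.1.le, hτ.2.le⟩
    have hτ₀I : τ₀ ∈ Set.Icc 0 t := ⟨hτ₀.1.le, hτ₀.2.le⟩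
    have hne : eLpNorm (u (j + 1) τ - u (j + 1) τ₀) ∞ volume ≠ ∞ :=
      ((hu.memLp_top (j + 1) τ ⟨hτ.1.le, hτ.2.trans ht.2⟩).sub
        (hu.memLp_top (j + 1) τ₀ ⟨hτ₀.1.le, hτ₀T.2⟩)).2.ne
    -- The function changes at fixed heat time, controlled by the `L^∞` distance `N τ`; the
    -- remaining change of heat time is `R τ`.
    have h1 : |heat (t - τ) (fun y => |u (j + 1) τ y| ^ p j) x -
        heat (t - τ) (fun y => |u (j + 1) τ₀ y| ^ p j) x| ≤ p j * M ^ (p j - 1) * N τ := by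
      rw [← heat_sub (sub_pos.2 hτ.2) (hint τ hτI) (hint τ₀ hτ₀I)]
      refine abs_heat_le_const (sub_pos.2 hτ.2) ?_ x
      filter_upwards [hM (j + 1) τ hτI, hM (j + 1) τ₀ hτ₀I, ae_abs_le_toReal_eLpNorm_top hne]
        with y h1 h2 h3
      refine (abs_rpow_sub_rpow_le (hp j) h1 h2).trans (mul_le_mul_of_nonneg_left h3 ?_)
      exact mul_nonneg (by linarith [hp j]) (Real.rpow_nonneg hM0 _)
    rw [Real.dist_eq]
    exact (abs_sub_le _ _ _).trans (add_le_add_left h1 _)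
  rw [intervalIntegrable_iff_integrableOn_Ioo_of_le ht.1.le]
  refine IntegrableOn.of_bound (by simp) (hcont.aestronglyMeasurable measurableSet_Ioo)
    (M ^ p j) ?_
  filter_upwards [ae_restrict_mem measurableSet_Ioo] with τ hτ
  exact abs_heat_le_const (sub_pos.2 hτ.2) (hpow τ ⟨hτ.1.le, hτ.2.le⟩) x

/-- Solutions of the integral equation are unique. -/
theorem IsSolution.ae_eq (hu : IsSolution p u₀ T u) (hv : IsSolution p u₀ T v)
    (hp : ∀ j, 1 ≤ p j) (j : Fin k) {t : ℝ} (ht : t ∈ Set.Ico 0 T) : u j t =ᵐ[volume] v j t := by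
  rcases ht.1.eq_or_lt with h0 | h0
  · rw [← h0]
    exact (hu.initial j).trans (hv.initial j).symm
  have htI : t ∈ Set.Ioo 0 T := ⟨h0, ht.2⟩
  obtain ⟨M₁, hM₁0, hM₁⟩ := hu.exists_bound htI
  obtain ⟨M₂, hM₂0, hM₂⟩ := hv.exists_bound htI
  set M := max M₁ M₂
  have hM0 : 0 ≤ M := hM₁0.trans (le_max_left _ _)
  set L := 1 + ∑ j, p j * M ^ (p j - 1)
  have hterm : ∀ j, 0 ≤ p j * M ^ (p j - 1) := fun j =>
    mul_nonneg (by linarith [hp j]) (Real.rpow_nonneg hM0 _)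
  have hLj : ∀ j, p j * M ^ (p j - 1) ≤ L := fun j => by
    have := Finset.single_le_sum (fun i _ => hterm i) (Finset.mem_univ j)
    linarith
  have hLpos : 0 < L := by
    have := Finset.sum_nonneg fun j (_ : j ∈ Finset.univ) => hterm j
    linarith
  -- Each use of the integral equation halves the bound in the weighted sup norm, starting from the
  -- trivial bound `2M`.
  have key : ∀ i : ℕ, ∀ j, ∀ s ∈ Set.Ioc 0 t, ∀ᵐ x, |u j s x - v j s x| ≤
      2 * M * (1 / 2) ^ i * Real.exp (2 * L * s) := by
    intro i
    induction i with
    | zero =>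
      intro j s hs
      filter_upwards [hM₁ j s ⟨hs.1.le, hs.2⟩, hM₂ j s ⟨hs.1.le, hs.2⟩] with x h1 h2
      have h3 : |u j s x - v j s x| ≤ 2 * M := by
        refine (abs_sub _ _).trans ?_
        linarith [le_max_left M₁ M₂, le_max_right M₁ M₂]
      rw [pow_zero, mul_one]
      exact h3.trans (le_mul_of_one_le_right (by positivity)
        (Real.one_le_exp (by have := hs.1; positivity)))
    | succ i ih =>
      intro j s hs
      have hsT : s ∈ Set.Ioo 0 T := ⟨hs.1, hs.2.trans_lt ht.2⟩
      filter_upwards [hu.duhamel j s hsT, hv.duhamel j s hsT] with x h1 h2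
      have hiu := hu.intervalIntegrable hp j hsT x
      have hiv := hv.intervalIntegrable hp j hsT x
      rw [h1, h2, add_sub_add_left_eq_sub, ← intervalIntegral.integral_sub hiu hiv]
      have hb : ∀ᵐ τ, τ ∈ Set.Ioc 0 s →
          ‖heat (s - τ) (fun y => |u (j + 1) τ y| ^ p j) x -
            heat (s - τ) (fun y => |v (j + 1) τ y| ^ p j) x‖ ≤
          L * (2 * M * (1 / 2) ^ i * Real.exp (2 * L * τ)) := by
        filter_upwards [Measure.ae_ne volume s] with τ hne hτ
        have hτs : τ < s := lt_of_le_of_ne hτ.2 hne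
        have hτI : τ ∈ Set.Icc 0 t := ⟨hτ.1.le, hτ.2.trans hs.2⟩
        have hτT : τ ∈ Set.Ico 0 T := ⟨hτ.1.le, hτs.trans hsT.2⟩
        rw [Real.norm_eq_abs, ← heat_sub (sub_pos.2 hτs)
          (integrable_abs_rpow (hu.memLp_one _ τ hτT) (hp j) (hM₁ _ τ hτI))
          (integrable_abs_rpow (hv.memLp_one _ τ hτT) (hp j) (hM₂ _ τ hτI))]
        refine abs_heat_le_const (sub_pos.2 hτs) ?_ x
        filter_upwards [hM₁ (j + 1) τ hτI, hM₂ (j + 1) τ hτI, ih (j + 1) τ ⟨hτ.1, hτI.2⟩]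
          with y h1 h2 h3
        exact (abs_rpow_sub_rpow_le (hp j) (h1.trans (le_max_left _ _))
          (h2.trans (le_max_right _ _))).trans (mul_le_mul (hLj j) h3 (abs_nonneg _) hLpos.le)
      refine (intervalIntegral.norm_integral_le_of_norm_le hs.1.le hb
        (Continuous.intervalIntegrable (by fun_prop) _ _)).trans
        ((integral_mul_exp_le (by positivity)).trans_eq ?_)
      rw [pow_succ]
      ring
  have hall : ∀ᵐ x, ∀ i : ℕ, |u j t x - v j t x| ≤
      2 * M * (1 / 2) ^ i * Real.exp (2 * L * t) :=
    ae_all_iff.2 fun i => key i j t ⟨h0, le_rfl⟩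
  filter_upwards [hall] with x hx
  have hlim := ((tendsto_pow_atTop_nhds_zero_of_lt_one (r := (1 / 2 : ℝ)) (by norm_num)
    (by norm_num)).const_mul (2 * M)).mul_const (Real.exp (2 * L * t))
  rw [mul_zero, zero_mul] at hlim
  have := ge_of_tendsto' hlim hx
  exact sub_eq_zero.1 (abs_nonpos_iff.1 this)

lemma IsSolution.congr_init {v₀ : Fin k → EuclideanSpace ℝ (Fin n) → ℝ}
    (hu : IsSolution p u₀ T u) (h : ∀ j, u₀ j =ᵐ[volume] v₀ j) : IsSolution p v₀ T u where
  memLp_one := hu.memLp_one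
  memLp_top := hu.memLp_top
  continuous_one := hu.continuous_one
  continuous_top := hu.continuous_top
  bounded_top := hu.bounded_top
  initial j := (hu.initial j).trans (h j)
  duhamel j t ht := by
    filter_upwards [hu.duhamel j t ht] with x hx
    rw [hx, heat_congr_ae t (h j) x]

lemma IsSolution.hasUniqueSolution (hu : IsSolution p u₀ T u) (hp : ∀ j, 1 ≤ p j) :
    HasUniqueSolution p u₀ T :=
  ⟨u, hu, fun _ hv j _ ht => hv.ae_eq hu hp j ht⟩

end Uniqueness

/-! ### The exponents `α` -/

section Alpha

variable {k : ℕ} [NeZero k]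

lemma couplingMatrix_mulVec (p v : Fin k → ℝ) (j : Fin k) :
    (couplingMatrix p *ᵥ v) j = p j * v (j + 1) := by
  simp [couplingMatrix, Matrix.mulVec, dotProduct]

open Fin.NatCast in
lemma eq_of_forall_eq_add_one {β : Type*} {f : Fin k → β} (h : ∀ j, f j = f (j + 1))
    (i j : Fin k) : f i = f j := by
  have h0 : ∀ r : ℕ, f (r : Fin k) = f 0 := by
    intro r
    induction r with
    | zero => simp
    | succ r ih => rw [Nat.cast_succ, ← h, ih]
  rw [← Fin.cast_val_eq_self i, ← Fin.cast_val_eq_self j, h0, h0]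

/-- A kernel vector satisfies `|v j| = p j |v (j+1)|`. Summing around the cycle gives `∑ (p j - 1)|v
(j+1)| = 0`, with nonnegative terms. So `|v|` is constant along the cycle, and it vanishes next to
an index with `p i ≠ 1`. -/
lemma isUnit_couplingMatrix_sub_one {p : Fin k → ℝ} (hp : ∀ j, 1 ≤ p j)
    (hp1 : p ≠ fun _ => 1) : IsUnit (couplingMatrix p - 1) := by
  rw [← Matrix.mulVec_injective_iff_isUnit]
  refine (injective_iff_map_eq_zero (Matrix.mulVecLin (couplingMatrix p - 1))).2 fun v hv => ?_
  have hrow : ∀ j, v j = p j * v (j + 1) := by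
    intro j
    have := congrFun hv j
    rw [Matrix.mulVecLin_apply, Matrix.sub_mulVec, Pi.sub_apply, couplingMatrix_mulVec,
      Matrix.one_mulVec, Pi.zero_apply] at this
    linarith
  have habs : ∀ j, |v j| = p j * |v (j + 1)| := fun j => by
    rw [hrow j, abs_mul, abs_of_nonneg (by linarith [hp j])]
  have hsum : ∑ j, (p j - 1) * |v (j + 1)| = 0 := by
    have h1 : ∑ j, |v (j + 1)| = ∑ j, |v j| := Equiv.sum_comp (Equiv.addRight 1) fun j => |v j|
    simp_rw [sub_mul, one_mul, Finset.sum_sub_distrib, h1, ← habs, sub_self]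
  rw [Finset.sum_eq_zero_iff_of_nonneg fun j _ =>
    mul_nonneg (by linarith [hp j]) (abs_nonneg _)] at hsum
  have hconst : ∀ j, |v j| = |v (j + 1)| := fun j => by
    have := hsum j (Finset.mem_univ j)
    linarith [habs j]
  obtain ⟨i, hi⟩ := Function.ne_iff.1 hp1
  have hi0 : |v (i + 1)| = 0 :=
    (mul_eq_zero.1 (hsum i (Finset.mem_univ i))).resolve_left (sub_ne_zero.2 hi)
  ext j
  rw [Pi.zero_apply, ← abs_eq_zero, ← hi0]
  exact eq_of_forall_eq_add_one (f := fun j => |v j|) hconst j (i + 1)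

/-- The cyclic recurrence satisfied by the exponents `α`. -/
lemma mul_alpha_add_one {p : Fin k → ℝ} (hp : ∀ j, 1 ≤ p j) (hp1 : p ≠ fun _ => 1)
    (j : Fin k) : p j * alpha p (j + 1) = alpha p j + 1 := by
  have hdet := (Matrix.isUnit_iff_isUnit_det _).1 (isUnit_couplingMatrix_sub_one hp hp1)
  have h : (couplingMatrix p - 1) *ᵥ alpha p = fun _ => 1 := by
    rw [alpha, Matrix.mulVec_mulVec, Matrix.mul_nonsing_inv _ hdet, Matrix.one_mulVec]
  have := congrFun h j
  rw [Matrix.sub_mulVec, Pi.sub_apply, couplingMatrix_mulVec, Matrix.one_mulVec] at this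
  linarith

lemma alpha_le_alphaMax (p : Fin k → ℝ) (j : Fin k) : alpha p j ≤ alphaMax p :=
  Finset.le_sup' (alpha p) (Finset.mem_univ j)

end Alpha

/-! ### Algebraic amplitudes and the lifespan -/

section Amplitudes

lemma amplitude_mul_eq {E δ x s q N : ℝ} (hE : 0 < E) (hδ : 0 < δ) (hx : 0 < x) :
    (δ / E * x ^ s) ^ q * (E * x ^ (-N)) ^ (q - 1) =
      δ ^ q / E * x ^ (s * q - N * (q - 1)) := by
  rw [Real.mul_rpow (by positivity) (by positivity), Real.mul_rpow hE.le (by positivity),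
    Real.div_rpow hδ.le hE.le, ← Real.rpow_mul hx.le, ← Real.rpow_mul hx.le,
    Real.rpow_sub_one hE.ne', show s * q - N * (q - 1) = s * q + -N * (q - 1) by ring,
    Real.rpow_add hx]
  have : E ^ q ≠ 0 := by positivity
  field_simp

lemma integral_one_add_rpow_le {κ t : ℝ} (hκ : 0 < κ) (ht : 0 ≤ t) :
    ∫ τ in (0 : ℝ)..t, (1 + τ) ^ (κ - 1) ≤ (1 + t) ^ κ / κ := by
  have hpos : ∀ τ ∈ Set.uIcc 0 t, 1 + τ ≠ 0 := fun τ hτ => by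
    rw [Set.uIcc_of_le ht] at hτ
    linarith [hτ.1]
  have hder : ∀ τ ∈ Set.uIcc 0 t, HasDerivAt (fun τ => (1 + τ) ^ κ / κ)
      ((1 + τ) ^ (κ - 1)) τ := by
    intro τ hτ
    have h := (((hasDerivAt_id' τ).const_add 1).rpow_const (p := κ)
      (Or.inl (hpos τ hτ))).div_const κ
    refine h.congr_deriv ?_
    field_simp
  have hcont : ContinuousOn (fun τ : ℝ => (1 + τ) ^ (κ - 1)) (Set.uIcc 0 t) :=
    ContinuousOn.rpow_const (by fun_prop) fun τ hτ => Or.inl (hpos τ hτ)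
  rw [intervalIntegral.integral_eq_sub_of_hasDerivAt hder hcont.intervalIntegrable]
  have : 0 ≤ (1 + (0 : ℝ)) ^ κ / κ := by positivity
  linarith

variable {n k : ℕ} [NeZero k] {p : Fin k → ℝ}

/-- Decay of the heat flow of a function whose `L¹` and `L^∞` norms are at most `ε`. -/
lemma heat_le_decay {w : EuclideanSpace ℝ (Fin n) → ℝ} {ε t : ℝ} (ht : 0 < t) (hε : 0 ≤ ε)
    (hw0 : ∀ x, 0 ≤ w x) (hw : Integrable w) (h1 : ∫ x, w x ≤ ε) (h2 : ∀ᵐ x, w x ≤ ε)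
    (x : EuclideanSpace ℝ (Fin n)) :
    heat t w x ≤ 2 ^ ((n : ℝ) / 2) * ε * (1 + t) ^ (-((n : ℝ) / 2)) := by
  have hN : (0 : ℝ) ≤ (n : ℝ) / 2 := by positivity
  rcases le_total t 1 with h | h
  · have h3 : heat t w x ≤ ε := (le_abs_self _).trans (abs_heat_le_const ht (by
      filter_upwards [h2] with y hy
      rwa [abs_of_nonneg (hw0 y)]) x)
    have h4 : (1 : ℝ) ≤ 2 ^ ((n : ℝ) / 2) * (1 + t) ^ (-((n : ℝ) / 2)) := by
      rw [Real.rpow_neg (by positivity), ← div_eq_mul_inv, one_le_div (by positivity)]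
      exact Real.rpow_le_rpow (by positivity) (by linarith) hN
    nlinarith
  · have h3 : heat t w x ≤ (4 * Real.pi * t) ^ (-((n : ℝ) / 2)) * ∫ y, |w y| :=
      (le_abs_self _).trans (abs_heat_le_decay ht hw x)
    simp_rw [abs_of_nonneg (hw0 _)] at h3
    have h4 : (4 * Real.pi * t) ^ (-((n : ℝ) / 2)) ≤ (1 + t) ^ (-((n : ℝ) / 2)) := by
      refine Real.rpow_le_rpow_of_nonpos (by positivity) ?_ (by linarith)
      nlinarith [Real.pi_gt_three]
    have h5 : (1 : ℝ) ≤ 2 ^ ((n : ℝ) / 2) := Real.one_le_rpow (by norm_num) hN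
    calc heat t w x ≤ (1 + t) ^ (-((n : ℝ) / 2)) * ε :=
          h3.trans (mul_le_mul h4 h1 (integral_nonneg hw0) (by positivity))
      _ ≤ 2 ^ ((n : ℝ) / 2) * ((1 + t) ^ (-((n : ℝ) / 2)) * ε) :=
          le_mul_of_one_le_left (by positivity) h5
      _ = _ := by ring

/-- The algebraic amplitudes form a supersolution. -/
lemma one_add_integral_amplitude_le {a : Fin k → ℝ} {γ lam E T N : ℝ}
    (hp : ∀ j, 1 ≤ p j) (ha : ∀ j, p j * a (j + 1) = a j + 1) (hγ : 0 ≤ γ)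
    (hσ : ∀ j, a j - γ ≤ N) (hκ : ∀ j, 0 < N - (a j - γ) + (p j - 1) * γ)
    (hlam : 0 < lam) (hlamκ : ∀ j, lam ≤ (N - (a j - γ) + (p j - 1) * γ) / 2) (hE : 0 < E)
    (hET : ∀ j, 2 * E ≤ lam ^ a j * (1 + T) ^ (-γ)) (j : Fin k) {t : ℝ}
    (ht : t ∈ Set.Ioc 0 T) :
    1 + ∫ τ in (0 : ℝ)..t,
      (lam ^ a (j + 1) * (1 + T) ^ (-γ) / E * (1 + |τ|) ^ (N - (a (j + 1) - γ))) ^ p j *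
        (E * (1 + |τ|) ^ (-N)) ^ (p j - 1) ≤
      lam ^ a j * (1 + T) ^ (-γ) / E * (1 + |t|) ^ (N - (a j - γ)) := by
  have hT : 0 < 1 + T := by linarith [ht.1, ht.2]
  have h1t : 0 < 1 + t := by linarith [ht.1]
  set κ := N - (a j - γ) + (p j - 1) * γ
  set δ := lam ^ a j * (1 + T) ^ (-γ) with hδ
  set δ' := lam ^ a (j + 1) * (1 + T) ^ (-γ) with hδ'
  have hδpos : 0 < δ := by positivity
  have hδ'pos : 0 < δ' := by positivity
  -- The recurrence for `a` identifies the power of `1 + τ` as `κ - 1`.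
  have hint : ∫ τ in (0 : ℝ)..t, (δ' / E * (1 + |τ|) ^ (N - (a (j + 1) - γ))) ^ p j *
      (E * (1 + |τ|) ^ (-N)) ^ (p j - 1) =
      δ' ^ p j / E * ∫ τ in (0 : ℝ)..t, (1 + τ) ^ (κ - 1) := by
    rw [← intervalIntegral.integral_const_mul]
    refine intervalIntegral.integral_congr fun τ hτ => ?_
    rw [Set.uIcc_of_le ht.1.le] at hτ
    have h1τ : 0 < 1 + τ := by linarith [hτ.1]
    simp only [abs_of_nonneg hτ.1]
    rw [amplitude_mul_eq hE hδ'pos h1τ]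
    congr 2
    have := ha j
    simp only [κ]
    linear_combination -this
  -- The weights `lam ^ a j` are chosen for this: by the recurrence, one step around the cycle gains
  -- exactly one factor `lam`, used to beat `1/κ`.
  have hδδ' : δ' ^ p j = lam * δ * (1 + T) ^ (-((p j - 1) * γ)) := by
    rw [hδ', hδ, Real.mul_rpow (by positivity) (by positivity), ← Real.rpow_mul hlam.le,
      ← Real.rpow_mul hT.le, mul_comm (a (j + 1)), ha j, Real.rpow_add_one hlam.ne',
      show -γ * p j = -γ + -((p j - 1) * γ) by ring, Real.rpow_add hT]
    ring
  have hle : (1 + T) ^ (-((p j - 1) * γ)) * (1 + t) ^ ((p j - 1) * γ) ≤ 1 := by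
    rw [Real.rpow_neg hT.le, inv_mul_le_iff₀ (by positivity), mul_one]
    exact Real.rpow_le_rpow h1t.le (by linarith [ht.2])
      (mul_nonneg (by linarith [hp j]) hγ)
  have hI := integral_one_add_rpow_le (hκ j) ht.1.le
  have hX : 0 < (1 + t) ^ (N - (a j - γ)) := by positivity
  have hhalf : δ' ^ p j / E * ∫ τ in (0 : ℝ)..t, (1 + τ) ^ (κ - 1) ≤
      δ / E * (1 + t) ^ (N - (a j - γ)) / 2 := by
    calc _ ≤ δ' ^ p j / E * ((1 + t) ^ κ / κ) :=
          mul_le_mul_of_nonneg_left hI (by positivity)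
      _ = (δ / E * (1 + t) ^ (N - (a j - γ))) * (lam / κ) *
          ((1 + T) ^ (-((p j - 1) * γ)) * (1 + t) ^ ((p j - 1) * γ)) := by
          rw [hδδ']
          simp only [κ]
          rw [Real.rpow_add h1t]
          ring
      _ ≤ (δ / E * (1 + t) ^ (N - (a j - γ))) * (1 / 2) * 1 := by
          have : lam / κ ≤ 1 / 2 := by
            rw [div_le_iff₀ (hκ j)]
            linarith [hlamκ j]
          have hκj := hκ j
          gcongr
      _ = _ := by ring
  -- The integral used half of the amplitude; the other half dominates the `1` from the initial
  -- value.
  have hone : 1 ≤ δ / E * (1 + t) ^ (N - (a j - γ)) / 2 := by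
    have h1 : 2 ≤ δ / E := (le_div_iff₀ hE).2 (hET j)
    have h2 : 1 ≤ (1 + t) ^ (N - (a j - γ)) :=
      Real.one_le_rpow (by linarith [ht.1]) (by linarith [hσ j])
    nlinarith
  rw [hint, abs_of_pos ht.1]
  linarith

/-- Initial values of size `ε` have a unique solution up to a time `T` with
`ε (1 + T)^γ` bounded by a constant. -/
theorem exists_forall_hasUniqueSolution {a : Fin k → ℝ} {γ : ℝ} (hp : ∀ j, 1 ≤ p j)
    (ha : ∀ j, p j * a (j + 1) = a j + 1) (hγ : 0 ≤ γ) (hσ : ∀ j, a j - γ ≤ (n : ℝ) / 2)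
    (hκ : ∀ j, 0 < (n : ℝ) / 2 - (a j - γ) + (p j - 1) * γ) :
    ∃ c : ℝ, 0 < c ∧ ∀ u₀ : Fin k → EuclideanSpace ℝ (Fin n) → ℝ,
      (∀ j, MemLp (u₀ j) 1 volume) → (∀ j, MemLp (u₀ j) ∞ volume) →
      ∀ ε : ℝ, 0 < ε → normL1Linf u₀ ≤ ENNReal.ofReal ε → ∀ T : ℝ, 0 < T →
      ε * (1 + T) ^ γ ≤ c → HasUniqueSolution p u₀ T := by
  obtain ⟨i₁, hi₁⟩ := Finite.exists_min fun j => ((n : ℝ) / 2 - (a j - γ) + (p j - 1) * γ) / 2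
  set lam := ((n : ℝ) / 2 - (a i₁ - γ) + (p i₁ - 1) * γ) / 2 with hlamdef
  have hlam : 0 < lam := half_pos (hκ i₁)
  obtain ⟨i₂, hi₂⟩ := Finite.exists_min fun j => lam ^ a j
  have hn2 : (0 : ℝ) < 2 ^ ((n : ℝ) / 2) := by positivity
  -- This `c` makes `ε (1+T)^γ ≤ c` imply `2E ≤ lam ^ a j · (1+T)^{-γ}` for all `j`, where `E =
  -- 2^{n/2} ε`.
  refine ⟨lam ^ a i₂ / (2 * 2 ^ ((n : ℝ) / 2)), by positivity,
    fun u₀ hu1 hutop ε hε hnorm T hT hεT => ?_⟩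
  have hmk : ∀ j, ∃ f : EuclideanSpace ℝ (Fin n) → ℝ, Measurable f ∧ u₀ j =ᵐ[volume] f :=
    fun j => ⟨(hu1 j).1.aemeasurable.mk, (hu1 j).1.aemeasurable.measurable_mk,
      (hu1 j).1.aemeasurable.ae_eq_mk⟩
  choose f hfm hfu using hmk
  have hf1 : ∀ j, MemLp (f j) 1 volume := fun j => (memLp_congr_ae (hfu j)).1 (hu1 j)
  have hftop : ∀ j, MemLp (f j) ∞ volume := fun j => (memLp_congr_ae (hfu j)).1 (hutop j)
  have hfnorm : ∑ j, ((eLpNorm (f j) 1 volume).toReal + (eLpNorm (f j) ∞ volume).toReal) ≤ ε := by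
    have h1 : normL1Linf f ≤ ENNReal.ofReal ε := by
      refine le_trans (le_of_eq ?_) hnorm
      unfold normL1Linf
      simp_rw [eLpNorm_congr_ae (hfu _)]
    have h2 := ENNReal.toReal_mono ENNReal.ofReal_ne_top h1
    rw [ENNReal.toReal_ofReal hε.le, normL1Linf, ENNReal.toReal_sum fun j _ =>
      ENNReal.add_ne_top.2 ⟨(hf1 j).2.ne, (hftop j).2.ne⟩] at h2
    simp_rw [ENNReal.toReal_add (hf1 _).2.ne (hftop _).2.ne] at h2
    exact h2
  rw [Finset.sum_add_distrib] at hfnorm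
  have hs1 : 0 ≤ ∑ j, (eLpNorm (f j) 1 volume).toReal :=
    Finset.sum_nonneg fun _ _ => ENNReal.toReal_nonneg
  have hs2 : 0 ≤ ∑ j, (eLpNorm (f j) ∞ volume).toReal :=
    Finset.sum_nonneg fun _ _ => ENNReal.toReal_nonneg
  set w : EuclideanSpace ℝ (Fin n) → ℝ := fun x => ∑ j, |f j x| with hwdef
  have hfi : ∀ j, Integrable (f j) := fun j => memLp_one_iff_integrable.1 (hf1 j)
  have hw : Integrable w := integrable_finsetSum _ fun j _ => (hfi j).abs
  have hw0 : ∀ x, 0 ≤ w x := fun x => Finset.sum_nonneg fun _ _ => abs_nonneg _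
  have hwint : ∫ x, w x ≤ ε := by
    rw [integral_finsetSum _ fun j _ => (hfi j).abs]
    have : ∀ j, ∫ x, |f j x| = (eLpNorm (f j) 1 volume).toReal := fun j => by
      rw [eLpNorm_one_eq_lintegral_enorm, ← integral_norm_eq_lintegral_enorm (hf1 j).1]
      rfl
    simp_rw [this]
    linarith
  have hwε : ∀ᵐ x, w x ≤ ε := by
    filter_upwards [ae_all_iff.2 fun j => ae_abs_le_toReal_eLpNorm_top (hftop j).2.ne] with x hx
    have := Finset.sum_le_sum fun j (_ : j ∈ Finset.univ) => hx j
    simp only [hwdef]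
    linarith
  set E := 2 ^ ((n : ℝ) / 2) * ε with hE
  have hEpos : 0 < E := by positivity
  have hET : ∀ j, 2 * E ≤ lam ^ a j * (1 + T) ^ (-γ) := by
    intro j
    have h1T : 0 < (1 + T) ^ γ := by positivity
    rw [Real.rpow_neg (by positivity), ← div_eq_mul_inv, le_div_iff₀ h1T]
    rw [le_div_iff₀ (by positivity)] at hεT
    refine le_trans (le_of_eq ?_) (hεT.trans (hi₂ j))
    rw [hE]
    ring
  have hne : ∀ τ : ℝ, 1 + |τ| ≠ 0 := fun τ => by positivity
  -- The absolute value of time keeps the amplitudes continuous and positive on all of `ℝ`.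
  have hS : Supersolution p f w
      (fun j t => lam ^ a j * (1 + T) ^ (-γ) / E * (1 + |t|) ^ ((n : ℝ) / 2 - (a j - γ)))
      (fun t => E * (1 + |t|) ^ (-((n : ℝ) / 2))) T :=
    { one_le := hp
      measurable_init := hfm
      abs_init_le := fun j x =>
        Finset.single_le_sum (fun i _ => abs_nonneg (f i x)) (Finset.mem_univ j)
      integrable := hw
      continuous_h := fun j => continuous_const.mul
        (Continuous.rpow_const (by fun_prop) fun τ => Or.inl (hne τ))
      continuous_m := continuous_const.mul
        (Continuous.rpow_const (by fun_prop) fun τ => Or.inl (hne τ))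
      h_nonneg := fun j t => by positivity
      m_pos := fun t => by positivity
      heat_le := fun t ht x => by
        rw [abs_of_pos ht.1]
        exact heat_le_decay ht.1 hε.le hw0 hw hwint hwε x
      super := fun j t ht => one_add_integral_amplitude_le hp ha hγ hσ hκ hlam hi₁ hEpos hET j
        ht }
  obtain ⟨u, hu⟩ := hS.exists_isSolution hwε hε.le
  exact (hu.congr_init fun j => (hfu j).symm).hasUniqueSolution hp

lemma ofReal_le_lifespan {u₀ : Fin k → EuclideanSpace ℝ (Fin n) → ℝ} {T : ℝ} (hT : 0 < T)
    (h : HasUniqueSolution p u₀ T) : ENNReal.ofReal T ≤ lifespan p u₀ :=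
  le_sSup ⟨T, hT, rfl, h⟩

lemma lifespan_eq_top {u₀ : Fin k → EuclideanSpace ℝ (Fin n) → ℝ}
    (h : ∀ T, 0 < T → HasUniqueSolution p u₀ T) : lifespan p u₀ = ∞ := by
  refine ENNReal.eq_top_of_forall_nnreal_le fun r => ?_
  have := ofReal_le_lifespan (by positivity : (0 : ℝ) < r + 1) (h _ (by positivity))
  refine le_trans ?_ this
  rw [← ENNReal.ofReal_coe_nnreal]
  exact ENNReal.ofReal_le_ofReal (by linarith)

end Amplitudes

end HeatSystem

end
theorem proposition1p3 (n k : ℕ) [NeZero k] (hn : 1 ≤ n) (p : Fin k → ℝ)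
    (hp : ∀ j, 1 ≤ p j) (hp1 : p ≠ fun _ => 1) :
    ∃ ε₀ : ℝ, 0 < ε₀ ∧ ∃ C : ℝ, 0 < C ∧
      ∀ u₀ : Fin k → EuclideanSpace ℝ (Fin n) → ℝ,
        (∀ j, MemLp (u₀ j) 1 volume) → (∀ j, MemLp (u₀ j) ∞ volume) →
        HeatSystem.normL1Linf u₀ ≤ ENNReal.ofReal ε₀ →
        (HeatSystem.alphaMax p < (n : ℝ) / 2 → HeatSystem.lifespan p u₀ = ∞) ∧
        ((n : ℝ) / 2 < HeatSystem.alphaMax p →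
          ENNReal.ofReal C *
              HeatSystem.normL1Linf u₀ ^ (-(1 / (HeatSystem.alphaMax p - (n : ℝ) / 2)))
            ≤ HeatSystem.lifespan p u₀) := by
  have ha := HeatSystem.mul_alpha_add_one hp hp1
  have hmax := HeatSystem.alpha_le_alphaMax p
  rcases lt_trichotomy (HeatSystem.alphaMax p) ((n : ℝ) / 2) with hlt | heq | hgt
  -- With `γ = 0` the smallness condition does not involve `T`.
  · obtain ⟨c, hc, hsol⟩ := HeatSystem.exists_forall_hasUniqueSolution (n := n) (γ := 0) hp ha
      le_rfl (fun j => by linarith [hmax j]) (fun j => by linarith [hmax j])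
    refine ⟨c, hc, 1, one_pos, fun u₀ h1 htop hnorm => ⟨fun _ => ?_, fun h => ?_⟩⟩
    · refine HeatSystem.lifespan_eq_top fun T hT => hsol u₀ h1 htop c hc hnorm T hT ?_
      rw [Real.rpow_zero, mul_one]
    · exact absurd h hlt.not_gt
  · refine ⟨1, one_pos, 1, one_pos, fun u₀ _ _ _ => ⟨fun h => ?_, fun h => ?_⟩⟩
    · exact absurd heq h.ne
    · exact absurd heq h.ne'
  · set γ := HeatSystem.alphaMax p - (n : ℝ) / 2 with hγdef
    have hγ : 0 < γ := sub_pos.2 hgt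
    obtain ⟨c, hc, hsol⟩ := HeatSystem.exists_forall_hasUniqueSolution (n := n) (γ := γ) hp ha
      -- Here `n/2 + γ = α_max`, so the quantity is `α_max - α j + (p j - 1)γ`. If `p j = 1`, the
      -- recurrence gives `α j + 1 = α (j+1) ≤ α_max`; otherwise the last summand is positive.
      hγ.le (fun j => by linarith [hmax j]) (fun j => by
        rcases (hp j).eq_or_lt with hj | hj
        · have h1 := ha j
          rw [← hj, one_mul] at h1
          rw [← hj]
          linarith [hmax (j + 1)]
        · have := mul_pos (sub_pos.2 hj) hγ
          linarith [hmax j])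
    -- The lifespan bound is `T = (c/ε)^{1/γ}/2`; the choice of `ε₀` forces `(c/ε)^{1/γ} ≥ 2`, hence
    -- `1 + T ≤ (c/ε)^{1/γ}`.
    refine ⟨c * 2 ^ (-γ), by positivity, 1 / 2 * c ^ (1 / γ), by positivity,
      fun u₀ h1 htop hnorm => ⟨fun h => absurd h hgt.not_gt, fun _ => ?_⟩⟩
    by_cases h0 : HeatSystem.normL1Linf u₀ = 0
    -- For zero data the size parameter is free and can be adapted to each `T`.
    · rw [HeatSystem.lifespan_eq_top fun T hT => hsol u₀ h1 htop (c * (1 + T) ^ (-γ))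
        (by positivity) (by rw [h0]; exact zero_le) T hT ?_]
      · exact le_top
      · rw [mul_assoc, ← Real.rpow_add (by positivity), neg_add_cancel, Real.rpow_zero, mul_one]
    · have hfin : HeatSystem.normL1Linf u₀ ≠ ∞ := ne_top_of_le_ne_top ENNReal.ofReal_ne_top hnorm
      set ε := (HeatSystem.normL1Linf u₀).toReal with hεdef
      have hε : 0 < ε := ENNReal.toReal_pos h0 hfin
      have hεeq : HeatSystem.normL1Linf u₀ = ENNReal.ofReal ε := (ENNReal.ofReal_toReal hfin).symm
      have hεle : ε ≤ c * 2 ^ (-γ) := by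
        rw [hεeq] at hnorm
        exact (ENNReal.ofReal_le_ofReal_iff (by positivity)).1 hnorm
      have h2 : (2 : ℝ) ≤ (c / ε) ^ (1 / γ) := by
        have h3 : (2 : ℝ) ^ γ ≤ c / ε := by
          rw [Real.rpow_neg (by norm_num), ← div_eq_mul_inv, le_div_iff₀ (by positivity)] at hεle
          rw [le_div_iff₀ hε]
          linarith
        have h4 := Real.rpow_le_rpow (by positivity) h3 (by positivity : 0 ≤ 1 / γ)
        rwa [← Real.rpow_mul (by norm_num), mul_one_div_cancel hγ.ne', Real.rpow_one] at h4
      have hT : 0 < 1 / 2 * (c / ε) ^ (1 / γ) := by positivity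
      have hsolT := hsol u₀ h1 htop ε hε hεeq.le _ hT (by
        have h3 : 1 + 1 / 2 * (c / ε) ^ (1 / γ) ≤ (c / ε) ^ (1 / γ) := by linarith
        have h4 := Real.rpow_le_rpow (by positivity) h3 hγ.le
        rw [← Real.rpow_mul (by positivity), one_div_mul_cancel hγ.ne', Real.rpow_one,
          le_div_iff₀ hε] at h4
        linarith)
      refine le_trans (le_of_eq ?_) (HeatSystem.ofReal_le_lifespan hT hsolT)
      rw [hεeq, ENNReal.ofReal_rpow_of_pos hε, ← ENNReal.ofReal_mul (by positivity), mul_assoc,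
        Real.rpow_neg hε.le, Real.div_rpow hc.le hε.le, div_eq_mul_inv (c ^ (1 / γ))]
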